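/- Fix $K\ge 1$, $\gamma\in(0,1/2)$, $\alpha\in(0,1)$ and constants $0<N_0\le N_1<1$. For each $n$ let $A_n\in\{0,1\}^{n\times n}$ have entries $A_{n,ij}\sim\mathrm{Bernoulli}(M_{n,ij})$ with $N_0\le M_{n,ij}\le N_1$, let $W_{n,ij}\sim\mathrm{Bernoulli}(\gamma)$, all these variables being mutually independent for each $n$, and put $A^{tr}_{n,ij}=A_{n,ij}(1-W_{n,ij})+(1-A_{n,ij})W_{n,ij}$ and $A^{te}_n=A_n$. A community detection method is applied to $A^{tr}_n$, possibly using auxiliary randomness independent of $(A_n,W_n)$, and returns $\hat Z_n\in\{0,1\}^{n\times K}$. Let $u_n\in\mathbb R^{K^2}$, $\|u_n\|_2=1$, where $u_n$ may depend on $A^{tr}_n$ and $\hat Z_n$. For $1\le k,\ell\le K$ and $s\in\{0,1\}$ put $$\mathcal I_{n,k\ell}=\{(i,j):\hat Z_{n,ik}=\hat Z_{n,j\ell}=1\},\qquad \mathcal I^{(s)}_{n,k\ell}=\{(i,j)\in\mathcal I_{n,k\ell}:A^{tr}_{n,ij}=s\}.$$ Target. Let $T_{n,ij}=M_{n,ij}\big/\big(M_{n,ij}+(1-M_{n,ij})(\tfrac{\gamma}{1-\gamma})^{2A^{tr}_{n,ij}-1}\big)$,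 $V^{(s)}_{n,k\ell}=|\mathcal I^{(s)}_{n,k\ell}|^{-1}\sum_{(i,j)\in\mathcal I^{(s)}_{n,k\ell}}T_{n,ij}$, $f(a,v)=\mathrm{expit}(\mathrm{logit}(a)+\log v)$, $$\Phi_{n,k\ell}=\frac{|\mathcal I^{(0)}_{n,k\ell}|}{|\mathcal I_{n,k\ell}|}f\Big(V^{(0)}_{n,k\ell},\frac{1-\gamma}{\gamma}\Big)+\frac{|\mathcal I^{(1)}_{n,k\ell}|}{|\mathcal I_{n,k\ell}|}f\Big(V^{(1)}_{n,k\ell},\frac{\gamma}{1-\gamma}\Big),\qquad \xi_n=u_n^\top\mathrm{vec}(\Phi_n).$$ Estimator. Let $c^{(0)}=\log\frac{\gamma}{1-\gamma}$, $c^{(1)}=\log\frac{1-\gamma}{\gamma}$, $\hat B^{(s)}_{n,k\ell}=|\mathcal I^{(s)}_{n,k\ell}|^{-1}\sum_{(i,j)\in\mathcal I^{(s)}_{n,k\ell}}A^{te}_{n,ij}$, $$\hat V^{(s)}_{n,k\ell}=\frac{\hat B^{(s)}_{n,k\ell}}{\hat B^{(s)}_{n,k\ell}+(1-\hat B^{(s)}_{n,k\ell})e^{c^{(s)}}},\qquad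 \hat\Phi_{n,k\ell}=\sum_{s\in\{0,1\}}\frac{|\mathcal I^{(s)}_{n,k\ell}|}{|\mathcal I_{n,k\ell}|}\hat V^{(s)}_{n,k\ell},\qquad \hat\xi_n=u_n^\top\mathrm{vec}(\hat\Phi_n),$$ $$\hat\Delta^{(s)}_{n,k\ell}=\frac{\hat B^{(s)}_{n,k\ell}(1-\hat B^{(s)}_{n,k\ell})e^{2c^{(s)}}}{|\mathcal I^{(s)}_{n,k\ell}|\big((1-\hat B^{(s)}_{n,k\ell})e^{c^{(s)}}+\hat B^{(s)}_{n,k\ell}\big)^4},\qquad \hat\Delta_{n,k\ell}=\sum_{s\in\{0,1\}}\frac{|\mathcal I^{(s)}_{n,k\ell}|^2}{|\mathcal I_{n,k\ell}|^2}\hat\Delta^{(s)}_{n,k\ell},\qquad \hat\sigma_n^2=u_n^\top\mathrm{diag}(\mathrm{vec}(\hat\Delta_n))u_n.$$ Let $\phi_{1-\alpha/2}$ be the $(1-\alpha/2)$-quantile of $\mathcal N(0,1)$. Let $(a_n)_n$, $(\hat z_n)_n$ be sequences of realizations of $A^{tr}_n$, $\hat Z_n$, where $\hat z_n$ has positive probability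 as an output of the community detection on the train network $a_n$, such that each node belongs to at most one community of $\hat z_n$, and such that, along these realizations, $|\mathcal I^{(s)}_{n,k\ell}|^{-1}=O(n^{-2})$ for $s\in\{0,1\}$ and all $k,\ell$ (in particular these sets are nonempty for all large $n$). Then $$\liminf_{n\to\infty}P\Big(\xi_n\in\big[\hat\xi_n-\phi_{1-\alpha/2}\hat\sigma_n,\ \hat\xi_n+\phi_{1-\alpha/2}\hat\sigma_n\big]\ \Big|\ A^{tr}_n=a_n,\ \hat Z_n=\hat z_n\Big)\ge 1-\alpha .$$ -/

import Mathlib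

open MeasureTheory ProbabilityTheory Filter Topology
open scoped Matrix

noncomputable section

namespace BernoulliNetwork

/-- Adjacency matrix of a directed binary network on `n` nodes, self-loops allowed
(`true` is an edge, `false` a non-edge). -/
abbrev Network (n : ℕ) : Type := Fin n → Fin n → Bool

/-- Community membership matrix in `{0,1}^{n × K}`: `z i k = true` means that node `i`
belongs to community `k`. -/
abbrev Membership (n K : ℕ) : Type := Fin n → Fin K → Bool

/-- The number `0` or `1` encoded by a Boolean. -/
def bit (b : Bool) : ℝ := if b then 1 else 0

/-- The train network: each entry of `A` is toggled exactly where `W` has an entry `1`. -/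
def train {n : ℕ} (A W : Network n) : Network n := fun i j => xor (A i j) (W i j)

theorem bit_train {n : ℕ} (A W : Network n) (i j : Fin n) :
    bit (train A W i j)
      = bit (A i j) * (1 - bit (W i j)) + (1 - bit (A i j)) * bit (W i j) := by
  unfold bit train
  cases A i j <;> cases W i j <;> simp

/-- The entries of `A` are Bernoulli with means `M i j`, the entries of the noise matrix `W` are
Bernoulli with mean `γ`, and all these `2 n²` random variables are mutually independent. -/
structure IsFission {Ω : Type*} [MeasurableSpace Ω] {n : ℕ} (P : Measure Ω)
    (M : Fin n → Fin n → unitInterval) (γ : unitInterval) (A W : Ω → Network n) : Prop where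
  measurable_edge : Measurable A
  measurable_noise : Measurable W
  law_edge : ∀ i j, HasLaw (fun ω => A ω i j) (bernoulliMeasure true false (M i j)) P
  law_noise : ∀ i j, HasLaw (fun ω => W ω i j) (bernoulliMeasure true false γ) P
  indep : iIndepFun
    (Sum.elim (fun (e : Fin n × Fin n) (ω : Ω) => A ω e.1 e.2)
      (fun (e : Fin n × Fin n) (ω : Ω) => W ω e.1 e.2)) P

/-- Each node belongs to at most one community. -/
def Membership.Disjoint {n K : ℕ} (z : Membership n K) : Prop :=
  ∀ i k l, z i k = true → z i l = true → k = l

/-- `I_{kl}`: ordered pairs from community `k` to community `l`. -/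
def block {n K : ℕ} (z : Membership n K) (k l : Fin K) : Finset (Fin n × Fin n) :=
  Finset.univ.filter fun e => z e.1 k = true ∧ z e.2 l = true

/-- `I^{(s)}_{kl}`: pairs of `I_{kl}` at which the train network `a` equals `s`. -/
def subBlock {n K : ℕ} (a : Network n) (z : Membership n K) (s : Bool) (k l : Fin K) :
    Finset (Fin n × Fin n) :=
  (block z k l).filter fun e => a e.1 e.2 = s

/-- `|I_n|⁻¹ = O(n⁻²)` for a sequence of finite sets, where the inverse has to make sense for all
large `n`, i.e. the sets are eventually nonempty. -/
def InvCardIsBigO {ι : ℕ → Type*} (I : (n : ℕ) → Finset (ι n)) : Prop :=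
  (∀ᶠ n in atTop, (I n).Nonempty) ∧
    (fun n => (((I n).card : ℝ))⁻¹) =O[atTop] (fun n : ℕ => (((n : ℝ) ^ 2))⁻¹)

/-- `logit p = log (p / (1 - p))`. -/
def logit (p : ℝ) : ℝ := Real.log (p / (1 - p))

/-- `f(a, v) = expit (logit a + log v)`. -/
def shift (a v : ℝ) : ℝ := Real.sigmoid (logit a + Real.log v)

/-- `T = m / (m + (1 - m) (γ / (1 - γ)) ^ (2 b - 1))`, the mean of an edge with mean `m`
conditional on the corresponding train edge being `b`. -/
def condMean (γ m : ℝ) (b : Bool) : ℝ :=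
  m / (m + (1 - m) * (γ / (1 - γ)) ^ (2 * (if b then 1 else 0) - 1 : ℤ))

/-- `V^{(s)}_{kl}`: average of `T_{ij}` over `I^{(s)}_{kl}`. -/
def V {n K : ℕ} (γ : ℝ) (M : Fin n → Fin n → unitInterval) (a : Network n)
    (z : Membership n K) (s : Bool) (k l : Fin K) : ℝ :=
  1 / ((subBlock a z s k l).card : ℝ)
    * ∑ e ∈ subBlock a z s k l, condMean γ (M e.1 e.2) (a e.1 e.2)

/-- The weight `|I^{(s)}_{kl}| / |I_{kl}|`. -/
def weight {n K : ℕ} (a : Network n) (z : Membership n K) (s : Bool) (k l : Fin K) : ℝ :=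
  ((subBlock a z s k l).card : ℝ) / ((block z k l).card : ℝ)

/-- The matrix `Φ`. -/
def Phi {n K : ℕ} (γ : ℝ) (M : Fin n → Fin n → unitInterval) (a : Network n)
    (z : Membership n K) : Matrix (Fin K) (Fin K) ℝ := fun k l =>
  weight a z false k l * shift (V γ M a z false k l) ((1 - γ) / γ)
    + weight a z true k l * shift (V γ M a z true k l) (γ / (1 - γ))

/-- The target `ξ = uᵀ vec(Φ)`. -/
def xi {n K : ℕ} (γ : ℝ) (M : Fin n → Fin n → unitInterval)
    (u : EuclideanSpace ℝ (Fin K × Fin K)) (a : Network n) (z : Membership n K) : ℝ :=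
  u.ofLp ⬝ᵥ Matrix.vec (Phi γ M a z)

/-- `c^{(0)} = log (γ / (1 - γ))` and `c^{(1)} = log ((1 - γ) / γ)`. -/
def c (γ : ℝ) (s : Bool) : ℝ :=
  if s then Real.log ((1 - γ) / γ) else Real.log (γ / (1 - γ))

/-- `B̂^{(s)}_{kl}`: average of the test network `A` over `I^{(s)}_{kl}`. -/
def Bhat {n K : ℕ} (A a : Network n) (z : Membership n K) (s : Bool) (k l : Fin K) : ℝ :=
  1 / ((subBlock a z s k l).card : ℝ) * ∑ e ∈ subBlock a z s k l, bit (A e.1 e.2)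

/-- `V̂^{(s)}_{kl}`. -/
def Vhat {n K : ℕ} (γ : ℝ) (A a : Network n) (z : Membership n K) (s : Bool)
    (k l : Fin K) : ℝ :=
  Bhat A a z s k l
    / (Bhat A a z s k l + (1 - Bhat A a z s k l) * Real.exp (c γ s))

/-- The matrix `Φ̂`. -/
def PhiHat {n K : ℕ} (γ : ℝ) (A a : Network n) (z : Membership n K) :
    Matrix (Fin K) (Fin K) ℝ := fun k l =>
  weight a z false k l * Vhat γ A a z false k l
    + weight a z true k l * Vhat γ A a z true k l

/-- The estimator `ξ̂ = uᵀ vec(Φ̂)`. -/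
def xiHat {n K : ℕ} (γ : ℝ) (u : EuclideanSpace ℝ (Fin K × Fin K)) (A a : Network n)
    (z : Membership n K) : ℝ :=
  u.ofLp ⬝ᵥ Matrix.vec (PhiHat γ A a z)

/-- `Δ̂^{(s)}_{kl}`. -/
def DeltaHatPart {n K : ℕ} (γ : ℝ) (A a : Network n) (z : Membership n K) (s : Bool)
    (k l : Fin K) : ℝ :=
  Bhat A a z s k l * (1 - Bhat A a z s k l) * Real.exp (2 * c γ s)
    / (((subBlock a z s k l).card : ℝ)
        * ((1 - Bhat A a z s k l) * Real.exp (c γ s) + Bhat A a z s k l) ^ 4)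

/-- The matrix `Δ̂`. -/
def DeltaHat {n K : ℕ} (γ : ℝ) (A a : Network n) (z : Membership n K) :
    Matrix (Fin K) (Fin K) ℝ := fun k l =>
  ∑ s : Bool, ((subBlock a z s k l).card : ℝ) ^ 2 / ((block z k l).card : ℝ) ^ 2
    * DeltaHatPart γ A a z s k l

/-- `σ̂ = √(uᵀ diag(vec Δ̂) u)`. -/
def sigmaHat {n K : ℕ} (γ : ℝ) (u : EuclideanSpace ℝ (Fin K × Fin K)) (A a : Network n)
    (z : Membership n K) : ℝ :=
  Real.sqrt (u.ofLp ⬝ᵥ (Matrix.diagonal (Matrix.vec (DeltaHat γ A a z)) *ᵥ u.ofLp))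

/-- The `p`-quantile of the standard normal distribution. -/
def normalQuantile (p : ℝ) : ℝ := sInf {x : ℝ | p ≤ cdf (gaussianReal 0 1) x}

end BernoulliNetwork

end

noncomputable section

/-! Given the train network, the test edges are independent Bernoulli variables with means `T`,
since each train edge involves only the same entry of `A` and `W`. Once the train network is fixed,
the detected communities depend on the auxiliary randomness alone, so conditioning on them does not
change this law; blocks, weights and direction are then deterministic.

The map `f` in the target and the map from `B̂` to `V̂` are the same function `tilt κ` with `κ =
e^c`. The error is therefore a combination of terms `tilt B - tilt V` over disjoint blocks, where
`B` is a block mean of edges and `V` its conditional expectation. A Taylor expansion gives a linear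
part, whose standard deviation `τ` is at least of order `1/n`, and a quadratic remainder of order
`n⁻²` in probability, because every block has of the order of `n²` entries. The linear part divided
by `τ` is a sum of small independent variables, hence asymptotically standard normal
(`tendsto_measureReal_abs_sum_le`).

The standard error uses `B (1 - B)` where `τ` contains the block average of `T (1 - T)`. By
concavity that average is at most `V (1 - V)`, and `B - V` tends to `0` in probability, so `σ̂ ≥ (1
- ε) τ` with probability tending to one. Edge heterogeneity inside a block can only widen the
interval, which is why coverage is a lower bound. These facts are combined in
`eventually_le_measureReal_abs_le_mul` and `eventually_le_measureReal_abs_sum_tilt_sub_le`; the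
conditional law is in `IsFission.iIndepFun_cond` and `IsFission.integral_bit_cond`. -/

/-! ### Central limit theorem for bounded triangular arrays -/

theorem Finset.norm_prod_sub_prod_le_sum {ι : Type*} (s : Finset ι) (f g : ι → ℂ)
    (hf : ∀ i ∈ s, ‖f i‖ ≤ 1) (hg : ∀ i ∈ s, ‖g i‖ ≤ 1) :
    ‖∏ i ∈ s, f i - ∏ i ∈ s, g i‖ ≤ ∑ i ∈ s, ‖f i - g i‖ := by
  classical
  induction s using Finset.induction_on with
  | empty => simp
  | insert a s ha ih =>
    have hfs : ‖∏ i ∈ s, f i‖ ≤ 1 := by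
      rw [norm_prod]
      exact Finset.prod_le_one (fun _ _ => norm_nonneg _)
        fun i hi => hf i (Finset.mem_insert_of_mem hi)
    have ih' := ih (fun i hi => hf i (Finset.mem_insert_of_mem hi))
      (fun i hi => hg i (Finset.mem_insert_of_mem hi))
    rw [Finset.prod_insert ha, Finset.prod_insert ha, Finset.sum_insert ha]
    -- Telescoping: one factor is exchanged at a time, and all the others have norm at most one.
    calc ‖f a * ∏ i ∈ s, f i - g a * ∏ i ∈ s, g i‖
        = ‖(f a - g a) * ∏ i ∈ s, f i + g a * (∏ i ∈ s, f i - ∏ i ∈ s, g i)‖ := by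
          congr 1; ring
      _ ≤ ‖f a - g a‖ * ‖∏ i ∈ s, f i‖ + ‖g a‖ * ‖∏ i ∈ s, f i - ∏ i ∈ s, g i‖ :=
          (norm_add_le _ _).trans (by rw [norm_mul, norm_mul])
      _ ≤ ‖f a - g a‖ * 1 + 1 * ∑ i ∈ s, ‖f i - g i‖ := by
          gcongr
          exact hg a (Finset.mem_insert_self a s)
      _ = _ := by ring

/-- A quantitative second order expansion of the characteristic function of a small centered
random variable. -/
theorem norm_charFun_sub_exp_le {Ω : Type*} [MeasurableSpace Ω] {μ : Measure Ω}
    [IsProbabilityMeasure μ] {X : Ω → ℝ} (hX : Measurable X) {δ t : ℝ}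
    (hδ : ∀ ω, |X ω| ≤ δ) (h0 : ∫ ω, X ω ∂μ = 0) (ht : |t| * δ ≤ 1) :
    ‖charFun (μ.map X) t - Real.exp (-(t ^ 2 * (∫ ω, X ω ^ 2 ∂μ) / 2))‖
      ≤ 2 * |t| ^ 3 * δ * ∫ ω, X ω ^ 2 ∂μ := by
  have hδ0 : 0 ≤ δ := by
    obtain ⟨ω⟩ : Nonempty Ω := nonempty_of_isProbabilityMeasure μ
    exact (abs_nonneg _).trans (hδ ω)
  have hsq : ∀ ω, X ω ^ 2 ≤ δ ^ 2 := fun ω => by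
    rw [← sq_abs]; exact pow_le_pow_left₀ (abs_nonneg _) (hδ ω) 2
  have iX : Integrable X μ := Integrable.of_bound hX.aestronglyMeasurable δ (ae_of_all _ hδ)
  have iX2 : Integrable (fun ω => X ω ^ 2) μ :=
    Integrable.of_bound (hX.pow_const 2).aestronglyMeasurable (δ ^ 2)
      (ae_of_all _ fun ω => by rw [Real.norm_eq_abs, abs_of_nonneg (sq_nonneg _)]; exact hsq ω)
  set v := ∫ ω, X ω ^ 2 ∂μ with hv
  have hv0 : 0 ≤ v := integral_nonneg fun ω => sq_nonneg _
  have hvδ : v ≤ δ ^ 2 := by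
    calc v ≤ ∫ _, δ ^ 2 ∂μ := integral_mono iX2 (integrable_const _) hsq
      _ = δ ^ 2 := by simp
  have hcf : charFun (μ.map X) t = ∫ ω, Complex.exp (t * X ω * Complex.I) ∂μ := by
    rw [charFun_apply_real, integral_map hX.aemeasurable]
    exact (by fun_prop : Measurable fun x : ℝ => Complex.exp (t * x * Complex.I)).aestronglyMeasurable
  have iE : Integrable (fun ω => Complex.exp (t * X ω * Complex.I)) μ := by
    refine Integrable.of_bound (by fun_prop) 1 (ae_of_all _ fun ω => ?_)
    rw [← Complex.ofReal_mul, Complex.norm_exp_ofReal_mul_I]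
  have iXc : Integrable (fun ω => (t * X ω * Complex.I : ℂ)) μ :=
    (iX.ofReal.const_mul (t : ℂ)).mul_const _
  have iX2c : Integrable (fun ω => (((t ^ 2 / 2 : ℝ) * (X ω ^ 2 : ℝ) : ℝ) : ℂ)) μ :=
    (iX2.const_mul _).ofReal
  have iL : Integrable (fun ω => (1 : ℂ) + t * X ω * Complex.I) μ := (integrable_const _).add iXc
  have iQ : Integrable (fun ω => (1 : ℂ) + t * X ω * Complex.I
      - (((t ^ 2 / 2 : ℝ) * (X ω ^ 2 : ℝ) : ℝ) : ℂ)) μ := iL.sub iX2c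
  have hpoly : ∫ ω, ((1 : ℂ) + t * X ω * Complex.I - (((t ^ 2 / 2 : ℝ) * (X ω ^ 2 : ℝ) : ℝ) : ℂ)) ∂μ
      = ((1 - t ^ 2 * v / 2 : ℝ) : ℂ) := by
    rw [integral_sub iL iX2c, integral_add (integrable_const _) iXc,
      integral_mul_const, integral_const_mul, integral_complex_ofReal, h0, integral_complex_ofReal,
      integral_const_mul, ← hv]
    simp
    ring
  -- Both sides are compared with `1 - t²v/2`, at a cost of `|t|³ δ v` each. Here one factor `|X|`
  -- of the cubic remainder is traded for `δ`; the error stays proportional to the variance and can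
  -- be summed over an array.
  have h1 : ‖charFun (μ.map X) t - ((1 - t ^ 2 * v / 2 : ℝ) : ℂ)‖ ≤ |t| ^ 3 * δ * v := by
    rw [hcf, ← hpoly, ← integral_sub iE iQ, hv,
      ← integral_const_mul]
    refine norm_integral_le_of_norm_le (iX2.const_mul _) (ae_of_all _ fun ω => ?_)
    have hn : ‖(t * X ω * Complex.I : ℂ)‖ = |t| * |X ω| := by simp
    have hle : ‖(t * X ω * Complex.I : ℂ)‖ ≤ 1 := by
      rw [hn]; exact (mul_le_mul_of_nonneg_left (hδ ω) (abs_nonneg _)).trans ht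
    have := Complex.exp_bound hle (n := 3) (by norm_num)
    have he : ∑ m ∈ Finset.range 3, (t * X ω * Complex.I : ℂ) ^ m / m.factorial
        = (1 : ℂ) + t * X ω * Complex.I - (((t ^ 2 / 2 : ℝ) * (X ω ^ 2 : ℝ) : ℝ) : ℂ) := by
      simp [Finset.sum_range_succ, mul_pow, Nat.factorial]
      ring
    rw [he, hn] at this
    refine this.trans ?_
    calc (|t| * |X ω|) ^ 3 * (((3 : ℕ).succ : ℝ) * (((3 : ℕ).factorial : ℝ) * (3 : ℕ))⁻¹)
        ≤ (|t| * |X ω|) ^ 3 * 1 := by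
          gcongr
          norm_num [Nat.factorial]
      _ = |t| ^ 3 * |X ω| * |X ω| ^ 2 := by ring
      _ ≤ |t| ^ 3 * δ * X ω ^ 2 := by
          rw [sq_abs]
          gcongr
          exact hδ ω
  have htd : t ^ 2 * δ ^ 2 ≤ 1 := by
    have : (|t| * δ) ^ 2 ≤ 1 := pow_le_one₀ (by positivity) ht
    rwa [mul_pow, sq_abs] at this
  have hy0 : 0 ≤ t ^ 2 * v / 2 := by positivity
  have hty : t ^ 2 * v ≤ 1 := (mul_le_mul_of_nonneg_left hvδ (sq_nonneg t)).trans htd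
  -- The error `t⁴v²` is absorbed through `v ≤ δ²` and `|t| δ ≤ 1`.
  have h2 : |Real.exp (-(t ^ 2 * v / 2)) - (1 - t ^ 2 * v / 2)| ≤ |t| ^ 3 * δ * v := by
    have := Real.exp_bound (x := -(t ^ 2 * v / 2)) (by rw [abs_neg, abs_of_nonneg hy0]; linarith)
      (n := 2) (by norm_num)
    have he : ∑ m ∈ Finset.range 2, (-(t ^ 2 * v / 2)) ^ m / (m.factorial : ℝ)
        = 1 - t ^ 2 * v / 2 := by
      simp [Finset.sum_range_succ]; ring
    rw [he, abs_neg, abs_of_nonneg hy0] at this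
    refine this.trans ?_
    have e1 : ((Nat.succ 2 : ℕ) : ℝ) / (((Nat.factorial 2 : ℕ) : ℝ) * (2 : ℕ)) ≤ 1 := by
      norm_num [Nat.factorial]
    calc (t ^ 2 * v / 2) ^ 2 * (((Nat.succ 2 : ℕ) : ℝ) / (((Nat.factorial 2 : ℕ) : ℝ) * (2 : ℕ)))
        ≤ (t ^ 2 * v / 2) ^ 2 * 1 := by gcongr
      _ = |t| ^ 4 * v * v / 4 := by rw [show |t| ^ 4 = (|t| ^ 2) ^ 2 by ring, sq_abs]; ring
      _ ≤ |t| ^ 4 * v * δ ^ 2 := by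
          have : 0 ≤ |t| ^ 4 * v := by positivity
          nlinarith [mul_le_mul_of_nonneg_left hvδ this, mul_nonneg this hv0]
      _ = |t| ^ 3 * δ * v * (|t| * δ) := by ring
      _ ≤ |t| ^ 3 * δ * v * 1 := by gcongr
      _ = _ := by ring
  calc _ = ‖(charFun (μ.map X) t - ((1 - t ^ 2 * v / 2 : ℝ) : ℂ))
        - ((Real.exp (-(t ^ 2 * v / 2)) - (1 - t ^ 2 * v / 2) : ℝ) : ℂ)‖ := by
        congr 1; push_cast; ring
    _ ≤ |t| ^ 3 * δ * v + |t| ^ 3 * δ * v := by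
        refine (norm_sub_le _ _).trans (add_le_add h1 ?_)
        rw [Complex.norm_real]; exact h2
    _ = _ := by ring

/-- A central limit theorem for triangular arrays of uniformly small independent centered random
variables, in terms of symmetric intervals. -/
theorem tendsto_measureReal_abs_sum_le {Ω : ℕ → Type*} [∀ n, MeasurableSpace (Ω n)]
    (μ : ∀ n, Measure (Ω n)) [∀ n, IsProbabilityMeasure (μ n)]
    {ι : ℕ → Type*} [∀ n, Fintype (ι n)] (X : ∀ n, ι n → Ω n → ℝ)
    (hX : ∀ n i, Measurable (X n i)) (hindep : ∀ n, iIndepFun (X n) (μ n))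
    (h0 : ∀ n i, ∫ ω, X n i ω ∂(μ n) = 0) {δ : ℕ → ℝ} (hδ : Tendsto δ atTop (𝓝 0))
    (hXδ : ∀ᶠ n in atTop, ∀ i ω, |X n i ω| ≤ δ n)
    (hvar : Tendsto (fun n => ∑ i, ∫ ω, X n i ω ^ 2 ∂(μ n)) atTop (𝓝 1)) (r : ℝ) :
    Tendsto (fun n => (μ n).real {ω | |∑ i, X n i ω| ≤ r}) atTop
      (𝓝 ((gaussianReal 0 1).real (Set.Icc (-r) r))) := by
  have hS : ∀ n, Measurable fun ω => ∑ i, X n i ω := fun n =>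
    Finset.measurable_sum _ fun i _ => hX n i
  let ν : ℕ → ProbabilityMeasure ℝ := fun n =>
    ⟨(μ n).map (fun ω => ∑ i, X n i ω), Measure.isProbabilityMeasure_map (hS n).aemeasurable⟩
  let ν₀ : ProbabilityMeasure ℝ := ⟨gaussianReal 0 1, inferInstance⟩
  have hν : Tendsto ν atTop (𝓝 ν₀) := by
    refine ProbabilityMeasure.tendsto_iff_tendsto_charFun.2 fun t => ?_
    have hlim : Tendsto (fun n =>
        ((Real.exp (-(t ^ 2 * (∑ i, ∫ ω, X n i ω ^ 2 ∂(μ n)) / 2)) : ℝ) : ℂ)) atTop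
        (𝓝 (charFun (ν₀ : Measure ℝ) t)) := by
      have : charFun (ν₀ : Measure ℝ) t = ((Real.exp (-(t ^ 2 * 1 / 2)) : ℝ) : ℂ) := by
        change charFun (gaussianReal 0 1) t = _
        rw [charFun_gaussianReal]
        push_cast
        congr 1
        simp
      rw [this]
      refine (Complex.continuous_ofReal.tendsto _).comp ((Real.continuous_exp.tendsto _).comp ?_)
      exact ((hvar.const_mul _).div_const _).neg
    -- The characteristic function of the sum and the Gaussian exponential are both products over
    -- `i`. Comparing factors bounds their distance by `2|t|³ δ` times the total variance, which
    -- tends to `0`.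
    refine tendsto_of_tendsto_of_dist hlim ?_
    have hb : Tendsto (fun n => 2 * |t| ^ 3 * δ n * ∑ i, ∫ ω, X n i ω ^ 2 ∂(μ n)) atTop (𝓝 0) := by
      simpa using (hδ.const_mul (2 * |t| ^ 3)).mul hvar
    have hsmall : ∀ᶠ n in atTop, |t| * δ n ≤ 1 := by
      have : Tendsto (fun n => |t| * δ n) atTop (𝓝 0) := by simpa using hδ.const_mul |t|
      exact this.eventually_le_const one_pos
    refine squeeze_zero' (Eventually.of_forall fun _ => dist_nonneg) ?_ hb
    filter_upwards [hXδ, hsmall] with n hn hs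
    have e1 : charFun (ν n : Measure ℝ) t = ∏ i, charFun ((μ n).map (X n i)) t := by
      change charFun ((μ n).map (fun ω => ∑ i, X n i ω)) t = _
      rw [(hindep n).charFun_map_fun_sum_eq_prod (fun i => (hX n i).aemeasurable),
        Finset.prod_apply]
    have e2 : ((Real.exp (-(t ^ 2 * (∑ i, ∫ ω, X n i ω ^ 2 ∂(μ n)) / 2)) : ℝ) : ℂ)
        = ∏ i, ((Real.exp (-(t ^ 2 * (∫ ω, X n i ω ^ 2 ∂(μ n)) / 2)) : ℝ) : ℂ) := by
      rw [← Complex.ofReal_prod, ← Real.exp_sum, Finset.sum_neg_distrib, Finset.mul_sum,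
        Finset.sum_div]
    rw [dist_comm, dist_eq_norm, e1, e2, Finset.mul_sum]
    refine (Finset.norm_prod_sub_prod_le_sum _ _ _ ?_ ?_).trans
      (Finset.sum_le_sum fun i _ => norm_charFun_sub_exp_le (hX n i) (hn i) (h0 n i) hs)
    · intro i _
      have := Measure.isProbabilityMeasure_map (μ := μ n) (hX n i).aemeasurable
      exact norm_charFun_le_one t
    · intro i _
      rw [Complex.norm_real, Real.norm_eq_abs, abs_of_pos (Real.exp_pos _), Real.exp_le_one_iff,
        neg_nonpos]
      have : 0 ≤ ∫ ω, X n i ω ^ 2 ∂(μ n) := integral_nonneg fun ω => sq_nonneg _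
      positivity
  -- Weak convergence gives convergence on the interval because its boundary is Gaussian-null.
  have hfr : (ν₀ : Measure ℝ) (frontier (Set.Icc (-r) r)) = 0 := by
    have : NullSingletonClass (gaussianReal 0 1) := nullSingletonClass_gaussianReal one_ne_zero
    change (gaussianReal 0 1) _ = 0
    refine measure_mono_null (t := {-r, r}) ?_ (Set.Finite.measure_zero (by simp) _)
    rcases le_or_gt (-r) r with h | h
    · rw [frontier_Icc h]
    · simp [Set.Icc_eq_empty (not_le.2 h)]
  have key := ProbabilityMeasure.tendsto_measure_of_null_frontier_of_tendsto' hν hfr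
  have key2 := (ENNReal.tendsto_toReal (measure_ne_top _ _)).comp key
  refine key2.congr fun n => ?_
  change ((μ n).map (fun ω => ∑ i, X n i ω) (Set.Icc (-r) r)).toReal = _
  rw [Measure.map_apply (hS n) measurableSet_Icc]
  congr 2
  ext ω
  simp [abs_le]

/-! ### Normal quantiles and coverage of symmetric intervals -/

/-- The inequality holds at every point above the infimum and passes to the infimum by right
continuity. -/
theorem le_cdf_normalQuantile {p : ℝ} (h0 : 0 < p) (h1 : p < 1) :
    p ≤ cdf (gaussianReal 0 1) (BernoulliNetwork.normalQuantile p) := by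
  set F := cdf (gaussianReal 0 1)
  set S : Set ℝ := {x : ℝ | p ≤ F x} with hS
  have hne : S.Nonempty :=
    ((tendsto_cdf_atTop (gaussianReal 0 1)).eventually_const_le h1).exists
  have hbdd : BddBelow S := by
    obtain ⟨x, hx⟩ := ((tendsto_cdf_atBot (gaussianReal 0 1)).eventually_lt_const h0).exists
    refine ⟨x, fun y hy => ?_⟩
    by_contra! h
    exact absurd (hy.trans (monotone_cdf _ h.le)) (not_le.2 hx)
  have hgt : ∀ y, BernoulliNetwork.normalQuantile p < y → p ≤ F y := fun y hy => by
    obtain ⟨x, hx, hxy⟩ := exists_lt_of_csInf_lt hne hy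
    exact (show p ≤ F x from hx).trans (monotone_cdf _ hxy.le)
  refine ge_of_tendsto (((F.right_continuous (BernoulliNetwork.normalQuantile p)).mono
    Set.Ioi_subset_Ici_self).tendsto) ?_
  filter_upwards [self_mem_nhdsWithin] with y hy using hgt y hy

/-- Each tail has mass at most `α / 2`: the upper one by the choice of quantile, the lower one by
symmetry. -/
theorem le_gaussianReal_Icc_normalQuantile {α : ℝ} (h0 : 0 < α) (h1 : α < 1) :
    1 - α ≤ (gaussianReal 0 1).real
      (Set.Icc (-BernoulliNetwork.normalQuantile (1 - α / 2))
        (BernoulliNetwork.normalQuantile (1 - α / 2))) := by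
  set q := BernoulliNetwork.normalQuantile (1 - α / 2) with hq
  have hcdf := le_cdf_normalQuantile (p := 1 - α / 2) (by linarith) (by linarith)
  rw [← hq, cdf_eq_real] at hcdf
  have hIoi : (gaussianReal 0 1).real (Set.Ioi q) ≤ α / 2 := by
    rw [← Set.compl_Iic, probReal_compl_eq_one_sub measurableSet_Iic]
    linarith
  have hIio : (gaussianReal 0 1).real (Set.Iio (-q)) ≤ α / 2 := by
    have : (gaussianReal 0 1).map (fun x => -x) = gaussianReal 0 1 := by
      rw [gaussianReal_map_neg, neg_zero]
    rw [← this, map_measureReal_apply measurable_neg measurableSet_Iio]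
    simpa using hIoi
  have hc : (Set.Icc (-q) q)ᶜ ⊆ Set.Iio (-q) ∪ Set.Ioi q := fun x hx => by
    by_contra h
    simp only [Set.mem_union, Set.mem_Iio, Set.mem_Ioi, not_or, not_lt] at h
    exact hx h
  have := (measureReal_mono (μ := gaussianReal 0 1) hc).trans (measureReal_union_le _ _)
  rw [probReal_compl_eq_one_sub measurableSet_Icc] at this
  linarith

/-- The gap between `r` and `q` is what later absorbs the remainder and the error in the estimated
scale. It exists because smaller intervals exhaust the open interval, and the endpoints carry no
mass. -/
theorem exists_lt_gaussianReal_Icc {a q : ℝ} (ha : 0 ≤ a)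
    (h : a < (gaussianReal 0 1).real (Set.Icc (-q) q)) :
    0 < q ∧ ∃ r < q, a < (gaussianReal 0 1).real (Set.Icc (-r) r) := by
  have : NullSingletonClass (gaussianReal 0 1) := nullSingletonClass_gaussianReal one_ne_zero
  have hq : 0 < q := by
    by_contra! hq
    have : (gaussianReal 0 1).real (Set.Icc (-q) q) = 0 := by
      rcases hq.lt_or_eq with hq | rfl
      · rw [Set.Icc_eq_empty (by linarith), measureReal_empty]
      · simp [measureReal_def]
    linarith
  refine ⟨hq, ?_⟩
  let s : ℕ → Set ℝ := fun n => Set.Icc (-(q - 1 / ((n : ℝ) + 1))) (q - 1 / ((n : ℝ) + 1))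
  have hmono : Monotone s := fun m n hmn => by
    have : 1 / ((n : ℝ) + 1) ≤ 1 / ((m : ℝ) + 1) := Nat.one_div_le_one_div hmn
    exact Set.Icc_subset_Icc (by linarith) (by linarith)
  have hU : ⋃ n, s n = Set.Ioo (-q) q := by
    ext x
    simp only [s, Set.mem_iUnion, Set.mem_Icc, Set.mem_Ioo]
    constructor
    · rintro ⟨n, h1, h2⟩
      have : 0 < 1 / ((n : ℝ) + 1) := Nat.one_div_pos_of_nat
      constructor <;> linarith
    · rintro ⟨h1, h2⟩
      obtain ⟨n, hn⟩ := exists_nat_one_div_lt (show 0 < q - |x| by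
        rw [sub_pos, abs_lt]; exact ⟨h1, h2⟩)
      have := abs_le.1 (show |x| ≤ q - 1 / ((n : ℝ) + 1) by linarith)
      exact ⟨n, this⟩
  have ht := tendsto_measure_iUnion_atTop (μ := gaussianReal 0 1) hmono
  rw [hU, Ioo_ae_eq_Icc.measure_eq] at ht
  have ht' := (ENNReal.tendsto_toReal (measure_ne_top _ _)).comp ht
  obtain ⟨n, hn⟩ := (ht'.eventually_const_lt h).exists
  have : 0 < 1 / ((n : ℝ) + 1) := Nat.one_div_pos_of_nat
  exact ⟨q - 1 / ((n : ℝ) + 1), by linarith, hn⟩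

/-- Asymptotic validity of a confidence interval `|D| ≤ q S` when `D` is dominated by an
asymptotically standard normal `L` and `S` does not underestimate the scale `τ` of `D`. -/
theorem eventually_le_measureReal_abs_le_mul {Ω : ℕ → Type*} [∀ n, MeasurableSpace (Ω n)]
    (μ : ∀ n, Measure (Ω n)) [∀ n, IsProbabilityMeasure (μ n)]
    (L D S : ∀ n, Ω n → ℝ) (τ : ℕ → ℝ) (hτ : ∀ n, 0 ≤ τ n)
    (hL : ∀ r, Tendsto (fun n => (μ n).real {ω | |L n ω| ≤ r}) atTop
      (𝓝 ((gaussianReal 0 1).real (Set.Icc (-r) r))))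
    (hgood : ∀ ε, 0 < ε → ε < 1 → ∃ G : ∀ n, Set (Ω n),
      Tendsto (fun n => (μ n).real (G n)ᶜ) atTop (𝓝 0) ∧
      ∀ᶠ n in atTop, ∀ ω ∈ G n, |D n ω| ≤ τ n * (|L n ω| + ε) ∧ τ n * (1 - ε) ≤ S n ω)
    {a q : ℝ} (ha : 0 ≤ a) (h : a < (gaussianReal 0 1).real (Set.Icc (-q) q)) :
    ∀ᶠ n in atTop, a ≤ (μ n).real {ω | |D n ω| ≤ q * S n ω} := by
  obtain ⟨hq, r, hr, har⟩ := exists_lt_gaussianReal_Icc ha h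
  obtain ⟨ε, hε0, hε1, hε⟩ : ∃ ε, 0 < ε ∧ ε < 1 ∧ r + ε ≤ q * (1 - ε) := by
    -- The requirement `r + ε ≤ q (1 - ε)` reads `ε (1 + q) ≤ q - r`; the `1 / 2` keeps `ε < 1`.
    refine ⟨min (1 / 2) ((q - r) / (1 + q)), ?_, ?_, ?_⟩
    · have : 0 < (q - r) / (1 + q) := div_pos (by linarith) (by linarith)
      exact lt_min (by norm_num) this
    · exact (min_le_left _ _).trans_lt (by norm_num)
    · have h2 := min_le_right (1 / 2) ((q - r) / (1 + q))
      rw [le_div_iff₀ (by linarith)] at h2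
      linarith
  obtain ⟨G, hG, hGe⟩ := hgood ε hε0 hε1
  have hd := ((hL r).sub hG).eventually_const_le (show a < _ by rw [sub_zero]; exact har)
  filter_upwards [hd, hGe] with n hn hGn
  have hsub : {ω | |L n ω| ≤ r} ⊆ {ω | |D n ω| ≤ q * S n ω} ∪ (G n)ᶜ := fun ω hω => by
    by_cases hωG : ω ∈ G n
    · left
      obtain ⟨h1, h2⟩ := hGn ω hωG
      have hω' : |L n ω| ≤ r := hω
      calc |D n ω| ≤ τ n * (|L n ω| + ε) := h1
        _ ≤ τ n * (q * (1 - ε)) := mul_le_mul_of_nonneg_left (by linarith) (hτ n)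
        _ = q * (τ n * (1 - ε)) := by ring
        _ ≤ q * S n ω := mul_le_mul_of_nonneg_left h2 hq.le
    · exact Or.inr hωG
  have := (measureReal_mono (μ := μ n) hsub).trans (measureReal_union_le _ _)
  linarith

/-! ### Analysis of the odds reparametrization -/

/-- The reparametrization `x ↦ x / (x + (1 - x) κ)` of `[0, 1]`, which multiplies odds by `κ⁻¹`. -/
def tilt (κ x : ℝ) : ℝ := x / (x + (1 - x) * κ)

/-- The derivative of `tilt κ`. -/
def tiltDeriv (κ x : ℝ) : ℝ := κ / (x + (1 - x) * κ) ^ 2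

/-- The delta-method variance of `tilt κ` at a Bernoulli mean. -/
def tiltVar (κ x : ℝ) : ℝ := x * (1 - x) * κ ^ 2 / ((1 - x) * κ + x) ^ 4

/-- The denominator is a convex combination of `1` and `κ`, hence bounded away from `0` on the whole
of `[0, 1]`. -/
theorem min_le_tiltDen {κ x : ℝ} (h0 : 0 ≤ x) (h1 : x ≤ 1) :
    min 1 κ ≤ x + (1 - x) * κ := by
  nlinarith [min_le_left 1 κ, min_le_right 1 κ]

theorem tiltDen_pos {κ x : ℝ} (hκ : 0 < κ) (h0 : 0 ≤ x) (h1 : x ≤ 1) :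
    0 < x + (1 - x) * κ :=
  (lt_min one_pos hκ).trans_le (min_le_tiltDen h0 h1)

theorem tiltVar_eq {κ : ℝ} (x : ℝ) :
    tiltVar κ x = tiltDeriv κ x ^ 2 * (x * (1 - x)) := by
  unfold tiltVar tiltDeriv
  rw [add_comm ((1 - x) * κ) x, div_pow, ← pow_mul]
  ring

/-- The Taylor remainder is an explicit rational multiple of `(y - x)²`. Asking for all large `C`
lets one constant serve finitely many `κ` simultaneously; the next bounds have this form for the
same reason. -/
theorem eventually_abs_tilt_sub_le {κ : ℝ} (hκ : 0 < κ) :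
    ∀ᶠ C in atTop, ∀ x y : ℝ, 0 ≤ x → x ≤ 1 → 0 ≤ y → y ≤ 1 →
      |tilt κ y - tilt κ x - tiltDeriv κ x * (y - x)| ≤ C * (y - x) ^ 2 := by
  set m := min 1 κ with hm
  have hm0 : 0 < m := lt_min one_pos hκ
  filter_upwards [eventually_ge_atTop (κ * |1 - κ| / m ^ 3)] with C hC x y hx0 hx1 hy0 hy1
  have hx := tiltDen_pos hκ hx0 hx1
  have hy := tiltDen_pos hκ hy0 hy1
  have hmx : m ≤ x + (1 - x) * κ := min_le_tiltDen hx0 hx1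
  have hmy : m ≤ y + (1 - y) * κ := min_le_tiltDen hy0 hy1
  have e : tilt κ y - tilt κ x - tiltDeriv κ x * (y - x)
      = -(κ * (1 - κ)) / ((x + (1 - x) * κ) ^ 2 * (y + (1 - y) * κ)) * (y - x) ^ 2 := by
    unfold tilt tiltDeriv
    rw [div_sub_div _ _ hy.ne' hx.ne', div_mul_eq_mul_div, div_sub_div _ _ (by positivity)
      (by positivity), div_mul_eq_mul_div, div_eq_div_iff (by positivity) (by positivity)]
    ring
  rw [e, abs_mul, abs_of_nonneg (sq_nonneg (y - x)), abs_div, abs_neg, abs_mul, abs_of_pos hκ,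
    abs_of_pos (show 0 < (x + (1 - x) * κ) ^ 2 * (y + (1 - y) * κ) by positivity)]
  refine mul_le_mul_of_nonneg_right (le_trans ?_ hC) (sq_nonneg _)
  rw [show m ^ 3 = m ^ 2 * m by ring]
  gcongr

theorem eventually_tiltDeriv_le {κ : ℝ} (hκ : 0 < κ) :
    ∀ᶠ C in atTop, ∀ x : ℝ, 0 ≤ x → x ≤ 1 → tiltDeriv κ x ≤ C := by
  have hm0 : 0 < min 1 κ := lt_min one_pos hκ
  filter_upwards [eventually_ge_atTop (κ / (min 1 κ) ^ 2)] with C hC x hx0 hx1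
  refine le_trans ?_ hC
  unfold tiltDeriv
  have := min_le_tiltDen (κ := κ) hx0 hx1
  gcongr

theorem eventually_le_tiltDeriv {κ : ℝ} (hκ : 0 < κ) :
    ∀ᶠ c in 𝓝[>] (0 : ℝ), ∀ x : ℝ, 0 ≤ x → x ≤ 1 → c ≤ tiltDeriv κ x := by
  have h : 0 < κ / (1 + κ) ^ 2 := by positivity
  filter_upwards [nhdsWithin_le_nhds (eventually_le_nhds h)] with c hc x hx0 hx1
  refine hc.trans ?_
  unfold tiltDeriv
  have := tiltDen_pos hκ hx0 hx1
  have h2 : x + (1 - x) * κ ≤ 1 + κ := by nlinarith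
  gcongr

theorem tiltVar_pos {κ x : ℝ} (hκ : 0 < κ) (h0 : 0 < x) (h1 : x < 1) : 0 < tiltVar κ x := by
  have := tiltDen_pos hκ h0.le h1.le
  have h2 : 0 < 1 - x := by linarith
  unfold tiltVar
  rw [add_comm ((1 - x) * κ) x]
  positivity

theorem continuousOn_tiltVar {κ : ℝ} (hκ : 0 < κ) :
    ContinuousOn (tiltVar κ) (Set.Icc 0 1) := by
  unfold tiltVar
  refine ContinuousOn.div (by fun_prop) (by fun_prop) fun x hx => ?_
  have := tiltDen_pos hκ hx.1 hx.2
  rw [add_comm ((1 - x) * κ) x]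
  positivity

/-- Uniform continuity on `[0, 1]` gives an additive error, which becomes relative because `tiltVar
κ` has a positive minimum on `[t₀, t₁]`. Only `x` is kept away from the endpoints: an empirical mean
`y` may equal `0` or `1`. -/
theorem eventually_mul_tiltVar_le {κ t₀ t₁ ε : ℝ} (hκ : 0 < κ) (h0 : 0 < t₀) (h1 : t₁ < 1)
    (hε : 0 < ε) :
    ∀ᶠ δ in 𝓝[>] (0 : ℝ), ∀ x y : ℝ, t₀ ≤ x → x ≤ t₁ → 0 ≤ y → y ≤ 1 → |y - x| ≤ δ →
      (1 - ε) * tiltVar κ x ≤ tiltVar κ y := by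
  rcases lt_or_ge t₁ t₀ with h | h
  · exact Eventually.of_forall fun δ x y hx hx' => by linarith
  have hsub : Set.Icc t₀ t₁ ⊆ Set.Icc (0 : ℝ) 1 := Set.Icc_subset_Icc h0.le h1.le
  obtain ⟨x₀, hx₀, hmin⟩ := isCompact_Icc.exists_isMinOn (Set.nonempty_Icc.2 h)
    ((continuousOn_tiltVar hκ).mono hsub)
  have hpos : 0 < tiltVar κ x₀ := tiltVar_pos hκ (h0.trans_le hx₀.1) (hx₀.2.trans_lt h1)
  obtain ⟨d, hd, hd'⟩ := Metric.uniformContinuousOn_iff.1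
    (isCompact_Icc.uniformContinuousOn_of_continuous (continuousOn_tiltVar hκ))
    (ε * tiltVar κ x₀) (by positivity)
  filter_upwards [nhdsWithin_le_nhds (eventually_lt_nhds hd)] with δ hδ x y hx0 hx1 hy0 hy1 hxy
  have h2 := hd' y ⟨hy0, hy1⟩ x (hsub ⟨hx0, hx1⟩) (by rw [Real.dist_eq]; exact hxy.trans_lt hδ)
  rw [Real.dist_eq] at h2
  have h3 : tiltVar κ x₀ ≤ tiltVar κ x := hmin ⟨hx0, hx1⟩
  have h4 := mul_le_mul_of_nonneg_left h3 hε.le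
  have h5 := (abs_lt.1 h2).1
  linarith

/-! ### Block means of independent Bernoulli variables -/

/-- The finsetMean of `f` over the finite set `s`. -/
def finsetMean {β : Type*} (s : Finset β) (f : β → ℝ) : ℝ := 1 / (s.card : ℝ) * ∑ e ∈ s, f e

theorem finsetMean_sub {β : Type*} (s : Finset β) (f g : β → ℝ) :
    finsetMean s f - finsetMean s g = ∑ e ∈ s, 1 / (s.card : ℝ) * (f e - g e) := by
  rw [← Finset.mul_sum, Finset.sum_sub_distrib, finsetMean, finsetMean]
  ring

theorem finsetMean_mem_Icc {β : Type*} {s : Finset β} (hs : s.Nonempty) {f : β → ℝ} {a b : ℝ}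
    (h : ∀ e ∈ s, a ≤ f e ∧ f e ≤ b) : a ≤ finsetMean s f ∧ finsetMean s f ≤ b := by
  have hc : (0 : ℝ) < s.card := by exact_mod_cast hs.card_pos
  have h1 := Finset.card_nsmul_le_sum s f a fun e he => (h e he).1
  have h2 := Finset.sum_le_card_nsmul s f b fun e he => (h e he).2
  rw [nsmul_eq_mul] at h1 h2
  unfold finsetMean
  rw [one_div, inv_mul_eq_div, le_div_iff₀ hc, div_le_iff₀ hc]
  constructor <;> linarith

/-- The mean of the Bernoulli variances is at most the Bernoulli variance of the mean. -/
theorem sum_mul_one_sub_le {β : Type*} {s : Finset β} (hs : s.Nonempty) (f : β → ℝ) :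
    ∑ e ∈ s, f e * (1 - f e) ≤ s.card * (finsetMean s f * (1 - finsetMean s f)) := by
  have hc : (0 : ℝ) < s.card := by exact_mod_cast hs.card_pos
  have h := sq_sum_le_card_mul_sum_sq (s := s) (f := f)
  have e1 : ∑ e ∈ s, f e * (1 - f e) = ∑ e ∈ s, f e - ∑ e ∈ s, f e ^ 2 := by
    rw [← Finset.sum_sub_distrib]
    exact Finset.sum_congr rfl fun e _ => by ring
  have e2 : (s.card : ℝ) * (finsetMean s f * (1 - finsetMean s f))
      = ∑ e ∈ s, f e - (∑ e ∈ s, f e) ^ 2 / s.card := by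
    unfold finsetMean
    field_simp
  rw [e1, e2]
  have : (∑ e ∈ s, f e) ^ 2 / s.card ≤ ∑ e ∈ s, f e ^ 2 := by
    rw [div_le_iff₀ hc]; linarith
  linarith

section Bernoulli

variable {Ω β : Type*} [MeasurableSpace Ω] {μ : Measure Ω} [IsProbabilityMeasure μ]

theorem integral_centered_sq {X : Ω → ℝ} (hX : Measurable X) (h01 : ∀ ω, X ω = 0 ∨ X ω = 1)
    {t : ℝ} (ht : ∫ ω, X ω ∂μ = t) :
    ∫ ω, (X ω - t) ∂μ = 0 ∧ ∫ ω, (X ω - t) ^ 2 ∂μ = t * (1 - t) := by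
  have iX : Integrable X μ := Integrable.of_bound hX.aestronglyMeasurable 1
    (ae_of_all _ fun ω => by rcases h01 ω with h | h <;> simp [h])
  constructor
  · rw [integral_sub iX (integrable_const _), ht]
    simp
  -- Since `X² = X`, the square is affine in `X`.
  · have e : ∀ ω, (X ω - t) ^ 2 = (1 - 2 * t) * X ω + t ^ 2 := fun ω => by
      rcases h01 ω with h | h <;> rw [h] <;> ring
    simp_rw [e]
    rw [integral_add (iX.const_mul _) (integrable_const _), integral_const_mul, ht]
    simp
    ring

theorem integral_finsetMean_sub_sq_le {X : β → Ω → ℝ} (hX : ∀ e, Measurable (X e))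
    (h01 : ∀ e ω, X e ω = 0 ∨ X e ω = 1) (hind : iIndepFun X μ) {T : β → ℝ}
    (hT : ∀ e, ∫ ω, X e ω ∂μ = T e) {s : Finset β} (hs : s.Nonempty) :
    ∫ ω, (finsetMean s (fun e => X e ω) - finsetMean s T) ^ 2 ∂μ ≤ (s.card : ℝ)⁻¹ := by
  have hc : (0 : ℝ) < s.card := by exact_mod_cast hs.card_pos
  let Y : β → Ω → ℝ := fun e ω => 1 / (s.card : ℝ) * (X e ω - T e)
  have hYm : ∀ e, Measurable (Y e) := fun e => ((hX e).sub_const _).const_mul _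
  have hXm : ∀ e, MemLp (X e) 2 μ := fun e =>
    MemLp.of_bound (hX e).aestronglyMeasurable 1
      (ae_of_all _ fun ω => by rcases h01 e ω with h | h <;> simp [h])
  have hY2 : ∀ e, MemLp (Y e) 2 μ := fun e => ((hXm e).sub (memLp_const _)).const_mul _
  have hY0 : ∀ e, ∫ ω, Y e ω ∂μ = 0 := fun e => by
    simp only [Y]
    rw [integral_const_mul, (integral_centered_sq (hX e) (h01 e) (hT e)).1, mul_zero]
  have hYind : iIndepFun Y μ :=
    hind.comp (fun e x => 1 / (s.card : ℝ) * (x - T e)) fun e => by fun_prop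
  have hvar := IndepFun.variance_sum (s := s) (μ := μ) (X := Y) (fun e _ => hY2 e)
    (fun i _ j _ hij => hYind.indepFun hij)
  have hsum : ∀ ω, (∑ e ∈ s, Y e) ω = finsetMean s (fun e => X e ω) - finsetMean s T := fun ω => by
    rw [Finset.sum_apply, finsetMean_sub]
  have hi0 : ∫ ω, (∑ e ∈ s, Y e) ω ∂μ = 0 := by
    simp only [Finset.sum_apply]
    rw [integral_finsetSum _ fun e _ => (hY2 e).integrable (by norm_num)]
    simp [hY0]
  have hSm : Measurable (∑ e ∈ s, Y e) := by fun_prop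
  rw [variance_of_integral_eq_zero hSm.aemeasurable hi0] at hvar
  simp_rw [hsum] at hvar
  rw [hvar]
  have hvY : ∀ e, variance (Y e) μ ≤ ((s.card : ℝ)⁻¹) ^ 2 := fun e => by
    rw [variance_of_integral_eq_zero (hYm e).aemeasurable (hY0 e)]
    simp only [Y, mul_pow]
    rw [integral_const_mul, (integral_centered_sq (hX e) (h01 e) (hT e)).2, one_div]
    refine mul_le_of_le_one_right (by positivity) ?_
    -- A Bernoulli variance is at most `1/4`; the cruder bound `1` suffices.
    nlinarith [sq_nonneg (T e - 1 / 2)]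
  refine (Finset.sum_le_card_nsmul s _ _ fun e _ => hvY e).trans (le_of_eq ?_)
  rw [nsmul_eq_mul]
  field_simp

end Bernoulli

/-! ### The delta method with a conservative standard error -/

/-- Coverage of plug-in confidence intervals for linear combinations of tilted block means of
independent Bernoulli variables. -/
theorem eventually_le_measureReal_abs_sum_tilt_sub_le {J : Type*} [Fintype J] {κ : J → ℝ}
    (hκ : ∀ j, 0 < κ j) {t₀ t₁ : ℝ} (ht₀ : 0 < t₀) (ht₁ : t₁ < 1)
    {Ω β : ℕ → Type*} [∀ n, MeasurableSpace (Ω n)]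
    (μ : ∀ n, Measure (Ω n)) [∀ n, IsProbabilityMeasure (μ n)]
    (X : ∀ n, β n → Ω n → ℝ) (hX : ∀ n e, Measurable (X n e))
    (h01 : ∀ n e ω, X n e ω = 0 ∨ X n e ω = 1) (hind : ∀ n, iIndepFun (X n) (μ n))
    (T : ∀ n, β n → ℝ) (hT : ∀ n e, ∫ ω, X n e ω ∂(μ n) = T n e)
    (hTt : ∀ n e, t₀ ≤ T n e ∧ T n e ≤ t₁)
    (I : ∀ n, J → Finset (β n)) (hI : ∀ n, Pairwise fun i j => Disjoint (I n i) (I n j))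
    {C c : ℝ} (hc : 0 < c) (hIC : ∀ᶠ n : ℕ in atTop, ∀ j,
      (I n j).Nonempty ∧ ((I n j).card : ℝ)⁻¹ ≤ C * ((n : ℝ) ^ 2)⁻¹)
    (b : ∀ _ : ℕ, J → ℝ) (hb : ∀ n j, |b n j| ≤ 1)
    (hbc : ∀ᶠ n : ℕ in atTop, c * ((n : ℝ) ^ 2)⁻¹ ≤ ∑ j, b n j ^ 2 / ((I n j).card : ℝ))
    {a q : ℝ} (ha : 0 ≤ a) (haq : a < (gaussianReal 0 1).real (Set.Icc (-q) q)) :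
    ∀ᶠ n in atTop, a ≤ (μ n).real {ω |
      |∑ j, b n j * (tilt (κ j) (finsetMean (I n j) fun e => X n e ω)
        - tilt (κ j) (finsetMean (I n j) (T n)))| ≤
      q * √(∑ j, b n j ^ 2 * (tiltVar (κ j) (finsetMean (I n j) fun e => X n e ω)
        / ((I n j).card : ℝ)))} := by
  classical
  -- uniform constants
  obtain ⟨C₂, hC₂⟩ := (eventually_all.2 fun j => eventually_abs_tilt_sub_le (hκ j)).exists
  obtain ⟨C₁, hC₁, hC₁0⟩ :=
    ((eventually_all.2 fun j => eventually_tiltDeriv_le (hκ j)).and (eventually_ge_atTop 0)).exists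
  obtain ⟨c₁, hc₁, hc₁0⟩ :=
    ((eventually_all.2 fun j => eventually_le_tiltDeriv (hκ j)).and self_mem_nhdsWithin).exists
  replace hc₁0 : 0 < c₁ := hc₁0
  have hderiv0 : ∀ j x, 0 ≤ tiltDeriv (κ j) x := fun j x =>
    div_nonneg (hκ j).le (sq_nonneg _)
  let V : ∀ _ : ℕ, J → ℝ := fun n j => finsetMean (I n j) (T n)
  let B : ∀ n : ℕ, J → Ω n → ℝ := fun n j ω => finsetMean (I n j) fun e => X n e ω
  have hV : ∀ n j, (I n j).Nonempty → t₀ ≤ V n j ∧ V n j ≤ t₁ := fun n j hs =>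
    finsetMean_mem_Icc hs fun e _ => hTt n e
  have hB : ∀ n j, (I n j).Nonempty → ∀ ω, 0 ≤ B n j ω ∧ B n j ω ≤ 1 := fun n j hs ω =>
    finsetMean_mem_Icc hs fun e _ => by rcases h01 n e ω with h | h <;> simp [h]
  -- variance of the linear part
  let w : ∀ _ : ℕ, J → ℝ := fun n j => b n j * tiltDeriv (κ j) (V n j)
  let τ : ℕ → ℝ := fun n =>
    √(∑ j, (w n j / (I n j).card) ^ 2 * ∑ e ∈ I n j, T n e * (1 - T n e))
  have hTT : ∀ n e, t₀ * (1 - t₁) ≤ T n e * (1 - T n e) := fun n e => by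
    obtain ⟨h1, h2⟩ := hTt n e
    exact mul_le_mul h1 (by linarith) (by linarith) (by linarith)
  have hT0 : ∀ n e, 0 ≤ T n e * (1 - T n e) := fun n e => by
    obtain ⟨h1, h2⟩ := hTt n e
    exact mul_nonneg (by linarith) (by linarith)
  have hτ0 : ∀ n, 0 ≤ τ n := fun n => Real.sqrt_nonneg _
  have hτsq : ∀ n, τ n ^ 2
      = ∑ j, (w n j / (I n j).card) ^ 2 * ∑ e ∈ I n j, T n e * (1 - T n e) := fun n =>
    Real.sq_sqrt (Finset.sum_nonneg fun j _ => mul_nonneg (sq_nonneg _)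
      (Finset.sum_nonneg fun e _ => hT0 n e))
  -- The scale is at least of order `1/n`: derivatives are at least `c₁`, Bernoulli variances at
  -- least `t₀ (1 - t₁)`, and `hbc` bounds the remaining sum.
  obtain ⟨c₂, hc₂, hτc⟩ : ∃ c₂ > 0, ∀ᶠ n : ℕ in atTop, c₂ / n ≤ τ n := by
    by_cases ht : t₀ ≤ t₁
    swap
    -- If `t₁ < t₀`, the positive sum in `hbc` provides an index `j`, and the mean over its nonempty
    -- block would lie between `t₀` and `t₁`.
    · refine ⟨1, one_pos, ?_⟩
      filter_upwards [hbc, hIC, eventually_gt_atTop 0] with n hn hn' hn0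
      exfalso
      have hn0' : (0 : ℝ) < n := by exact_mod_cast hn0
      have : 0 < ∑ j, b n j ^ 2 / ((I n j).card : ℝ) := lt_of_lt_of_le (by positivity) hn
      obtain ⟨j, _, _⟩ := Finset.exists_ne_zero_of_sum_ne_zero this.ne'
      exact ht ((hV n j (hn' j).1).1.trans (hV n j (hn' j).1).2)
    refine ⟨√(c₁ ^ 2 * (t₀ * (1 - t₁)) * c), Real.sqrt_pos.2 ?_, ?_⟩
    · have : 0 < 1 - t₁ := by linarith
      positivity
    filter_upwards [hbc, hIC, eventually_gt_atTop 0] with n hn hn' hn0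
    have hn0' : (0 : ℝ) < n := by exact_mod_cast hn0
    have h1t : 0 < 1 - t₁ := by linarith
    refine Real.le_sqrt_of_sq_le ?_
    rw [div_pow, Real.sq_sqrt (by positivity), div_eq_mul_inv, mul_assoc]
    refine (mul_le_mul_of_nonneg_left hn (by positivity)).trans ?_
    rw [Finset.mul_sum]
    refine Finset.sum_le_sum fun j _ => ?_
    have hcard : (0 : ℝ) < (I n j).card := by exact_mod_cast (hn' j).1.card_pos
    have hs : (I n j).card * (t₀ * (1 - t₁)) ≤ ∑ e ∈ I n j, T n e * (1 - T n e) := by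
      have := Finset.card_nsmul_le_sum (I n j) (fun e => T n e * (1 - T n e)) _
        fun e _ => hTT n e
      rwa [nsmul_eq_mul] at this
    obtain ⟨hV1, hV2⟩ := hV n j (hn' j).1
    have hd : c₁ ^ 2 ≤ tiltDeriv (κ j) (V n j) ^ 2 :=
      pow_le_pow_left₀ hc₁0.le (hc₁ j _ (by linarith) (by linarith)) 2
    calc c₁ ^ 2 * (t₀ * (1 - t₁)) * (b n j ^ 2 / (I n j).card)
        ≤ tiltDeriv (κ j) (V n j) ^ 2 * (t₀ * (1 - t₁)) * (b n j ^ 2 / (I n j).card) := by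
          gcongr
      _ = (w n j / (I n j).card) ^ 2 * ((I n j).card * (t₀ * (1 - t₁))) := by
          simp only [w]
          field_simp
      _ ≤ _ := by gcongr
  have hτpos : ∀ᶠ n : ℕ in atTop, 0 < τ n := by
    filter_upwards [hτc, eventually_gt_atTop 0] with n hn hn0
    have hn0' : (0 : ℝ) < n := by exact_mod_cast hn0
    exact lt_of_lt_of_le (by positivity) hn
  -- the linear part as a sum of independent variables
  let Y : ∀ n, (Σ j, I n j) → Ω n → ℝ := fun n p ω =>
    w n p.1 / (I n p.1).card / τ n * (X n p.2 ω - T n p.2)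
  let L : ∀ n, Ω n → ℝ := fun n ω => ∑ p, Y n p ω
  -- Disjointness of the blocks means that no variable is used twice, so the summands inherit
  -- independence.
  have hinj : ∀ n, Function.Injective fun p : Σ j, I n j => (p.2 : β n) := by
    rintro n ⟨i, e, he⟩ ⟨j, f, hf⟩ h
    obtain rfl : e = f := h
    obtain rfl : i = j := by
      by_contra hij
      exact Finset.disjoint_left.1 (hI n hij) he hf
    rfl
  have hLeq : ∀ n, 0 < τ n → ∀ ω, τ n * L n ω = ∑ j, w n j * (B n j ω - V n j) := by
    intro n hn ω
    simp only [L, Y, Finset.mul_sum, B, V]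
    rw [Fintype.sum_sigma]
    refine Finset.sum_congr rfl fun j _ => ?_
    rw [finsetMean_sub, Finset.mul_sum, ← Finset.sum_coe_sort (I n j)]
    refine Finset.sum_congr rfl fun e _ => ?_
    field_simp
  have hLlim : ∀ r, Tendsto (fun n => (μ n).real {ω | |L n ω| ≤ r}) atTop
      (𝓝 ((gaussianReal 0 1).real (Set.Icc (-r) r))) := by
    -- A summand is at most the product of `C₁` (coefficient), `C n⁻²` (inverse block size) and `n /
    -- c₂` (inverse scale), which gives this `δ`.
    refine fun r => tendsto_measureReal_abs_sum_le μ Y (fun n p => ?_) (fun n => ?_)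
      (fun n p => ?_) (δ := fun n => C₁ * C / c₂ * (n : ℝ)⁻¹) ?_ ?_ ?_ r
    · exact ((hX n _).sub_const _).const_mul _
    · exact ((hind n).precomp (hinj n)).comp
        (fun p x => w n p.1 / (I n p.1).card / τ n * (x - T n p.2)) fun p => by fun_prop
    · simp only [Y]
      rw [integral_const_mul, (integral_centered_sq (hX n _) (h01 n _) (hT n _)).1, mul_zero]
    · simpa using tendsto_inv_atTop_nhds_zero_nat.const_mul (C₁ * C / c₂)
    · filter_upwards [hτc, hIC, hτpos, eventually_gt_atTop 0] with n hn hn' hτn hn0 p ω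
      have hn0' : (0 : ℝ) < n := by exact_mod_cast hn0
      obtain ⟨hV1, hV2⟩ := hV n p.1 (hn' p.1).1
      have hx : |X n p.2 ω - T n p.2| ≤ 1 := by
        obtain ⟨h1, h2⟩ := hTt n p.2
        rcases h01 n p.2 ω with h | h <;> rw [h, abs_le] <;> constructor <;> linarith
      have hw : |w n p.1| ≤ C₁ := by
        simp only [w, abs_mul, abs_of_nonneg (hderiv0 _ _)]
        calc _ ≤ 1 * C₁ := mul_le_mul (hb n _) (hC₁ _ _ (by linarith) (by linarith))
              (hderiv0 _ _) zero_le_one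
          _ = C₁ := one_mul _
      have hC0 : 0 ≤ C * ((n : ℝ) ^ 2)⁻¹ := le_trans (by positivity) (hn' p.1).2
      calc |Y n p ω| = |w n p.1| * ((I n p.1).card : ℝ)⁻¹ * (τ n)⁻¹ * |X n p.2 ω - T n p.2| := by
            simp only [Y]
            rw [abs_mul, abs_div, abs_div, abs_of_pos hτn, Nat.abs_cast, div_eq_mul_inv,
              div_eq_mul_inv]
        _ ≤ C₁ * (C * ((n : ℝ) ^ 2)⁻¹) * (c₂ / n)⁻¹ * 1 := by
            gcongr
            exact (hn' p.1).2
        _ = C₁ * C / c₂ * (n : ℝ)⁻¹ := by field_simp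
    -- By the choice of `τ` the total variance is exactly `1` as soon as `τ n > 0`.
    · refine Tendsto.congr' ?_ tendsto_const_nhds
      filter_upwards [hτpos] with n hn
      symm
      have : ∀ p, ∫ ω, Y n p ω ^ 2 ∂(μ n)
          = (τ n ^ 2)⁻¹ * ((w n p.1 / (I n p.1).card) ^ 2 * (T n p.2 * (1 - T n p.2))) := fun p => by
        simp only [Y, mul_pow]
        rw [integral_const_mul, (integral_centered_sq (hX n _) (h01 n _) (hT n _)).2, div_pow]
        field_simp
      simp_rw [this]
      rw [← Finset.mul_sum, inv_mul_eq_one₀ (by positivity), hτsq, Fintype.sum_sigma]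
      refine Finset.sum_congr rfl fun j _ => ?_
      rw [Finset.mul_sum, ← Finset.sum_coe_sort (I n j)]
  -- consistency of the block means
  let Q : ∀ n, Ω n → ℝ := fun n ω => ∑ j, (B n j ω - V n j) ^ 2
  have hBm : ∀ n j, Measurable (B n j) := fun n j =>
    (Finset.measurable_sum _ fun e _ => hX n e).const_mul _
  have hiQ : ∀ n, (∀ j, (I n j).Nonempty) → ∀ j,
      Integrable (fun ω => (B n j ω - V n j) ^ 2) (μ n) := by
    intro n hn j
    refine Integrable.of_bound (((hBm n j).sub_const _).pow_const 2).aestronglyMeasurable 1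
      (ae_of_all _ fun ω => ?_)
    obtain ⟨h1, h2⟩ := hB n j (hn j) ω
    obtain ⟨h3, h4⟩ := hV n j (hn j)
    rw [Real.norm_eq_abs, abs_pow]
    exact pow_le_one₀ (abs_nonneg _) (by rw [abs_le]; constructor <;> linarith)
  -- Markov's inequality: `Q` has mean `O(n⁻²)`, so it falls below `η / n`, the order of the lower
  -- bound on `τ`, with probability tending to one.
  have hQlim : ∀ η > 0, Tendsto (fun n : ℕ => (μ n).real {ω | Q n ω < η / n}ᶜ) atTop (𝓝 0) := by
    intro η hη
    have hlim : Tendsto (fun n : ℕ => Fintype.card J * C / η * (n : ℝ)⁻¹) atTop (𝓝 0) := by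
      simpa using tendsto_inv_atTop_nhds_zero_nat.const_mul (Fintype.card J * C / η)
    refine squeeze_zero' (Eventually.of_forall fun _ => measureReal_nonneg) ?_ hlim
    filter_upwards [hIC, eventually_gt_atTop 0] with n hn hn0
    have hn0' : (0 : ℝ) < n := by exact_mod_cast hn0
    have hset : {ω | Q n ω < η / n}ᶜ = {ω | η / n ≤ Q n ω} := by ext; simp
    have hM := mul_meas_ge_le_integral_of_nonneg (μ := μ n) (f := Q n)
      (ae_of_all _ fun ω => Finset.sum_nonneg fun j _ => sq_nonneg _)
      (integrable_finsetSum _ fun j _ => hiQ n (fun j => (hn j).1) j) (η / n)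
    have hE : ∫ ω, Q n ω ∂(μ n) ≤ Fintype.card J * (C * ((n : ℝ) ^ 2)⁻¹) := by
      simp only [Q]
      rw [integral_finsetSum _ fun j _ => hiQ n (fun j => (hn j).1) j]
      refine (Finset.sum_le_card_nsmul _ _ (C * ((n : ℝ) ^ 2)⁻¹) fun j _ =>
        (integral_finsetMean_sub_sq_le (hX n) (h01 n) (hind n) (hT n) (hn j).1).trans
          (hn j).2).trans ?_
      rw [nsmul_eq_mul, Finset.card_univ]
    rw [hset]
    have := hM.trans hE
    rw [← le_div_iff₀' (by positivity)] at this
    refine this.trans (le_of_eq ?_)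
    field_simp
  refine eventually_le_measureReal_abs_le_mul μ L _ _ τ hτ0 hLlim (fun ε hε0 hε1 => ?_) ha haq
  obtain ⟨δ, hδ, hδ0⟩ := ((eventually_all.2 fun j =>
    eventually_mul_tiltVar_le (hκ j) ht₀ ht₁ hε0).and self_mem_nhdsWithin).exists
  replace hδ0 : 0 < δ := hδ0
  -- The first entry forces `|B - V| ≤ δ`; the second makes the Taylor remainder at most `ε τ`. The
  -- `+ 1` guards against `C₂ = 0`.
  let η := min (δ ^ 2) (ε * c₂ / (|C₂| + 1))
  have hη : 0 < η := lt_min (by positivity) (by positivity)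
  have hη1 : η ≤ δ ^ 2 := min_le_left _ _
  have hη2 : |C₂| * η ≤ ε * c₂ := by
    have := min_le_right (δ ^ 2) (ε * c₂ / (|C₂| + 1))
    rw [le_div_iff₀ (by positivity)] at this
    change η * (|C₂| + 1) ≤ _ at this
    nlinarith
  refine ⟨fun n => {ω | Q n ω < η / n}, hQlim η hη, ?_⟩
  filter_upwards [hτc, hIC, hτpos, eventually_gt_atTop 0] with n hn hn' hτn hn0 ω hω
  replace hω : Q n ω < η / n := hω
  have hn0' : (1 : ℝ) ≤ n := by exact_mod_cast hn0
  have hn0'' : (0 : ℝ) < n := by linarith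
  have hVj := fun j => hV n j (hn' j).1
  have hBj := fun j => hB n j (hn' j).1 ω
  constructor
  · change |∑ j, b n j * (tilt (κ j) (B n j ω) - tilt (κ j) (V n j))| ≤ _
    have e : ∑ j, b n j * (tilt (κ j) (B n j ω) - tilt (κ j) (V n j))
        = τ n * L n ω + ∑ j, b n j * (tilt (κ j) (B n j ω) - tilt (κ j) (V n j)
          - tiltDeriv (κ j) (V n j) * (B n j ω - V n j)) := by
      rw [hLeq n hτn, ← Finset.sum_add_distrib]
      refine Finset.sum_congr rfl fun j _ => ?_
      simp only [w]
      ring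
    have hrem : |∑ j, b n j * (tilt (κ j) (B n j ω) - tilt (κ j) (V n j)
          - tiltDeriv (κ j) (V n j) * (B n j ω - V n j))| ≤ |C₂| * Q n ω := by
      refine (Finset.abs_sum_le_sum_abs _ _).trans ?_
      simp only [Q]
      rw [Finset.mul_sum]
      refine Finset.sum_le_sum fun j _ => ?_
      rw [abs_mul]
      have h1 := hC₂ j (V n j) (B n j ω) (by linarith [(hVj j).1]) (by linarith [(hVj j).2])
        (hBj j).1 (hBj j).2
      have h2 := mul_le_mul_of_nonneg_right (le_abs_self C₂) (sq_nonneg (B n j ω - V n j))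
      calc _ ≤ 1 * (|C₂| * (B n j ω - V n j) ^ 2) :=
            mul_le_mul (hb n j) (h1.trans h2) (abs_nonneg _) zero_le_one
        _ = _ := one_mul _
    rw [e]
    calc _ ≤ |τ n * L n ω| + |C₂| * Q n ω := (abs_add_le _ _).trans (by gcongr)
      _ ≤ τ n * |L n ω| + |C₂| * (η / n) := by
          rw [abs_mul, abs_of_pos hτn]
          gcongr
      _ ≤ τ n * |L n ω| + ε * (c₂ / n) := by
          rw [← mul_div_assoc, ← mul_div_assoc]
          gcongr
      _ ≤ τ n * |L n ω| + ε * τ n := by gcongr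
      _ = _ := by ring
  -- Squaring produces `(1 - ε)²`. One factor is discarded, and the other pays for replacing `V` by
  -- `B` in `tiltVar`.
  · refine Real.le_sqrt_of_sq_le ?_
    change _ ≤ ∑ j, b n j ^ 2 * (tiltVar (κ j) (B n j ω) / (I n j).card)
    calc (τ n * (1 - ε)) ^ 2 = (1 - ε) * ((1 - ε) * τ n ^ 2) := by ring
      _ ≤ 1 * ((1 - ε) * τ n ^ 2) := by
          gcongr
          linarith
      _ = ∑ j, (1 - ε) * ((w n j / (I n j).card) ^ 2 * ∑ e ∈ I n j, T n e * (1 - T n e)) := by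
          rw [one_mul, hτsq, Finset.mul_sum]
      _ ≤ _ := Finset.sum_le_sum fun j _ => ?_
    have hcard : (0 : ℝ) < (I n j).card := by exact_mod_cast (hn' j).1.card_pos
    have hd : |B n j ω - V n j| ≤ δ := by
      refine abs_le_of_sq_le_sq ?_ hδ0.le
      calc (B n j ω - V n j) ^ 2 ≤ Q n ω :=
            Finset.single_le_sum (f := fun j => (B n j ω - V n j) ^ 2)
              (fun j _ => sq_nonneg _) (Finset.mem_univ j)
        _ ≤ η / n := hω.le
        _ ≤ η := div_le_self hη.le hn0'
        _ ≤ δ ^ 2 := hη1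
    have hg := hδ j (V n j) (B n j ω) (hVj j).1 (hVj j).2 (hBj j).1 (hBj j).2 hd
    -- This is the conservative step: the true variance within a block is at most the one computed
    -- from the block mean.
    have hJ : ∑ e ∈ I n j, T n e * (1 - T n e) ≤ (I n j).card * (V n j * (1 - V n j)) :=
      sum_mul_one_sub_le (hn' j).1 (T n)
    calc (1 - ε) * ((w n j / (I n j).card) ^ 2 * ∑ e ∈ I n j, T n e * (1 - T n e))
        ≤ (1 - ε) * ((w n j / (I n j).card) ^ 2 * ((I n j).card * (V n j * (1 - V n j)))) := by
          gcongr
      _ = b n j ^ 2 * ((1 - ε) * tiltVar (κ j) (V n j) / (I n j).card) := by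
          rw [tiltVar_eq]
          simp only [w]
          field_simp
      _ ≤ _ := by gcongr

/-! ### Independence of pairs and conditioning on independent events -/

/-- On a countable space laws are determined by singletons, and both laws give a point the product
of all its coordinate probabilities. -/
theorem ProbabilityTheory.iIndepFun.prodMk_of_sumElim {Ω ι α : Type*} [MeasurableSpace Ω]
    {P : Measure Ω} [Fintype ι] [Countable α] [MeasurableSpace α]
    [MeasurableSingletonClass α] {f g : ι → Ω → α} (hf : ∀ i, Measurable (f i))
    (hg : ∀ i, Measurable (g i)) (h : iIndepFun (Sum.elim f g) P) :
    iIndepFun (fun i ω => (f i ω, g i ω)) P := by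
  have := h.isProbabilityMeasure
  have hfg : ∀ i, Measurable fun ω => (f i ω, g i ω) := fun i => (hf i).prodMk (hg i)
  have hprob : ∀ i, IsProbabilityMeasure (P.map fun ω => (f i ω, g i ω)) := fun i =>
    Measure.isProbabilityMeasure_map (hfg i).aemeasurable
  rw [iIndepFun_iff_map_fun_eq_pi_map fun i => (hfg i).aemeasurable]
  refine Measure.ext_of_singleton fun x => ?_
  rw [Measure.pi_singleton, Measure.map_apply (measurable_pi_lambda _ hfg)
    (measurableSet_singleton x)]
  have hpair : ∀ i, (P.map fun ω => (f i ω, g i ω)) {x i}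
      = P (f i ⁻¹' {(x i).1}) * P (g i ⁻¹' {(x i).2}) := fun i => by
    rw [Measure.map_apply (hfg i) (measurableSet_singleton _)]
    have hi : IndepFun (f i) (g i) P := h.indepFun (i := Sum.inl i) (j := Sum.inr i) (by simp)
    rw [← hi.measure_inter_preimage_eq_mul _ _ (measurableSet_singleton _)
      (measurableSet_singleton _)]
    congr 1
    ext ω
    simp [Prod.ext_iff]
  simp_rw [hpair]
  have hall := h.meas_iInter (s := Sum.elim (fun i => f i ⁻¹' {(x i).1})
    (fun i => g i ⁻¹' {(x i).2})) (by
      rintro (i | i)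
      · exact ⟨_, measurableSet_singleton _, rfl⟩
      · exact ⟨_, measurableSet_singleton _, rfl⟩)
  rw [Fintype.prod_sum_type, ← Finset.prod_mul_distrib] at hall
  simp only [Sum.elim_inl, Sum.elim_inr] at hall
  rw [← hall]
  congr 1
  ext ω
  simp [funext_iff, Prod.ext_iff, forall_and]

/-- Conditioning on an additional independent event has no effect. -/
theorem cond_inter_real_eq {Ω : Type*} [MeasurableSpace Ω] {P : Measure Ω} [IsFiniteMeasure P]
    {S₁ S₂ T T' : Set Ω} (h₁ : MeasurableSet S₁) (h₂ : MeasurableSet S₂)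
    (hT : ∀ ω ∈ S₁ ∩ S₂, ω ∈ T ↔ ω ∈ T') (hi : P (S₁ ∩ S₂) = P S₁ * P S₂)
    (hi' : P (S₁ ∩ T' ∩ S₂) = P (S₁ ∩ T') * P S₂) (h0 : P S₂ ≠ 0) :
    (P[|S₁ ∩ S₂]).real T = (P[|S₁]).real T' := by
  have hset : S₁ ∩ S₂ ∩ T = S₁ ∩ T' ∩ S₂ := by
    ext ω
    have := hT ω
    simp only [Set.mem_inter_iff] at this ⊢
    tauto
  rw [measureReal_def, measureReal_def, cond_apply (h₁.inter h₂), cond_apply h₁, hset, hi, hi']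
  simp only [ENNReal.toReal_mul, ENNReal.toReal_inv]
  have : (P S₂).toReal ≠ 0 := ENNReal.toReal_ne_zero.2 ⟨h0, measure_ne_top _ _⟩
  rw [mul_inv, mul_assoc, mul_comm (P (S₁ ∩ T')).toReal, inv_mul_cancel_left₀ this]

/-! ### Law of the test network given the train network -/

namespace BernoulliNetwork

theorem condMean_eq_tilt {γ : ℝ} (h0 : 0 < γ) (h1 : γ < 1 / 2) (m : ℝ) (b : Bool) :
    condMean γ m b = tilt (if b then γ / (1 - γ) else (1 - γ) / γ) m := by
  have : 1 - γ ≠ 0 := by linarith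
  cases b <;> simp [condMean, tilt]

/-- With fractions cleared, the denominator averages `γ` and `1 - γ`, so it is at most `1 - γ`. The
numerators of the mean and of its complement are at least `N₀ γ` and `(1 - N₁) γ`, as `γ < 1 - γ`.
-/
theorem condMean_mem_Icc {γ m N₀ N₁ : ℝ} (h0 : 0 < γ) (h1 : γ < 1 / 2) (hN₀ : 0 < N₀)
    (hN₁ : N₁ < 1) (hm : N₀ ≤ m ∧ m ≤ N₁) (b : Bool) :
    N₀ * (γ / (1 - γ)) ≤ condMean γ m b ∧ condMean γ m b ≤ 1 - (1 - N₁) * (γ / (1 - γ)) := by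
  have hγ : 0 < 1 - γ := by linarith
  obtain ⟨hm0, hm1⟩ := hm
  rw [condMean_eq_tilt h0 h1]
  unfold tilt
  cases b
  · have hD : 0 < m + (1 - m) * ((1 - γ) / γ) := tiltDen_pos (by positivity) (by linarith)
      (by linarith)
    have e : m + (1 - m) * ((1 - γ) / γ) = (m * γ + (1 - m) * (1 - γ)) / γ := by field_simp
    simp only [Bool.false_eq_true, if_false]
    rw [e] at hD ⊢
    have hD' : 0 < m * γ + (1 - m) * (1 - γ) := by
      rcases div_pos_iff.1 hD with h | h <;> linarith [h.1]
    have hle : m * γ + (1 - m) * (1 - γ) ≤ 1 - γ := by nlinarith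
    rw [div_div_eq_mul_div]
    constructor
    · rw [← mul_div_assoc]
      have h3 : 0 ≤ m * γ := mul_nonneg (by linarith) h0.le
      gcongr
    · rw [le_sub_iff_add_le', ← mul_div_assoc, ← le_sub_iff_add_le]
      have : 1 - m * γ / (m * γ + (1 - m) * (1 - γ))
          = (1 - m) * (1 - γ) / (m * γ + (1 - m) * (1 - γ)) := by
        rw [one_sub_div hD'.ne']
        congr 1
        ring
      rw [this]
      have h2 : (1 - N₁) * γ ≤ (1 - m) * (1 - γ) :=
        mul_le_mul (by linarith) (by linarith) h0.le (by linarith)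
      have h3 : 0 ≤ (1 - m) * (1 - γ) := mul_nonneg (by linarith) hγ.le
      gcongr
  · have hD : 0 < m + (1 - m) * (γ / (1 - γ)) := tiltDen_pos (by positivity) (by linarith)
      (by linarith)
    have e : m + (1 - m) * (γ / (1 - γ)) = (m * (1 - γ) + (1 - m) * γ) / (1 - γ) := by field_simp
    simp only [if_true]
    rw [e] at hD ⊢
    have hD' : 0 < m * (1 - γ) + (1 - m) * γ := by
      rcases div_pos_iff.1 hD with h | h <;> linarith [h.1]
    have hle : m * (1 - γ) + (1 - m) * γ ≤ 1 - γ := by nlinarith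
    rw [div_div_eq_mul_div]
    constructor
    · rw [← mul_div_assoc]
      have h2 : N₀ * γ ≤ m * (1 - γ) := mul_le_mul hm0 (by linarith) h0.le (by linarith)
      have h3 : 0 ≤ m * (1 - γ) := mul_nonneg (by linarith) hγ.le
      gcongr
    · rw [le_sub_iff_add_le', ← mul_div_assoc, ← le_sub_iff_add_le]
      have : 1 - m * (1 - γ) / (m * (1 - γ) + (1 - m) * γ)
          = (1 - m) * γ / (m * (1 - γ) + (1 - m) * γ) := by
        rw [one_sub_div hD'.ne']
        congr 1
        ring
      rw [this]
      have h3 : 0 ≤ (1 - m) * γ := mul_nonneg (by linarith) h0.le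
      have h2 : (1 - N₁) * γ ≤ (1 - m) * γ := by gcongr
      gcongr

section Fission

theorem setOf_train_eq {Ω : Type*} {n : ℕ} (A W : Ω → Network n) (a : Network n) :
    {ω | train (A ω) (W ω) = a}
      = ⋂ e : Fin n × Fin n, (fun ω => train (A ω) (W ω) e.1 e.2) ⁻¹' {a e.1 e.2} := by
  ext ω
  simp [funext_iff, Prod.forall]

variable {Ω : Type*} [MeasurableSpace Ω] {P : Measure Ω} {n : ℕ}
  {M : Fin n → Fin n → unitInterval} {γ : unitInterval} {A W : Ω → Network n}

theorem IsFission.measurable_edge_apply (h : IsFission P M γ A W) (e : Fin n × Fin n) :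
    Measurable fun ω => A ω e.1 e.2 := by
  have := h.measurable_edge
  fun_prop

theorem IsFission.measurable_noise_apply (h : IsFission P M γ A W) (e : Fin n × Fin n) :
    Measurable fun ω => W ω e.1 e.2 := by
  have := h.measurable_noise
  fun_prop

theorem IsFission.real_inter (h : IsFission P M γ A W) (e : Fin n × Fin n) (x y : Bool) :
    P.real {ω | A ω e.1 e.2 = x ∧ W ω e.1 e.2 = y}
      = (if x then (M e.1 e.2 : ℝ) else 1 - M e.1 e.2) * (if y then (γ : ℝ) else 1 - γ) := by
  have hi : IndepFun (fun ω => A ω e.1 e.2) (fun ω => W ω e.1 e.2) P :=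
    h.indep.indepFun (i := Sum.inl e) (j := Sum.inr e) (by simp)
  have hA : P.real ((fun ω => A ω e.1 e.2) ⁻¹' {x})
      = if x then (M e.1 e.2 : ℝ) else 1 - M e.1 e.2 := by
    rw [← map_measureReal_apply (h.measurable_edge_apply e) (measurableSet_singleton x),
      (h.law_edge e.1 e.2).map_eq]
    cases x <;> simp
  have hW : P.real ((fun ω => W ω e.1 e.2) ⁻¹' {y}) = if y then (γ : ℝ) else 1 - γ := by
    rw [← map_measureReal_apply (h.measurable_noise_apply e) (measurableSet_singleton y),
      (h.law_noise e.1 e.2).map_eq]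
    cases y <;> simp
  have := hi.measure_inter_preimage_eq_mul {x} {y} (measurableSet_singleton _)
    (measurableSet_singleton _)
  rw [← hA, ← hW, measureReal_def, measureReal_def, measureReal_def, ← ENNReal.toReal_mul, ← this]
  rfl

theorem measurable_train (h : IsFission P M γ A W) (e : Fin n × Fin n) :
    Measurable fun ω => train (A ω) (W ω) e.1 e.2 := by
  have h1 := (h.measurable_edge_apply e).prodMk (h.measurable_noise_apply e)
  exact (measurable_of_countable fun p : Bool × Bool => xor p.1 p.2).comp h1

/-- Each pair is a function of `(A, W)` at its own entry. Dependence between its two components is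
harmless for conditioning entry by entry. -/
theorem IsFission.iIndepFun_pair (h : IsFission P M γ A W) :
    iIndepFun (fun (e : Fin n × Fin n) ω => (A ω e.1 e.2, train (A ω) (W ω) e.1 e.2)) P :=
  (iIndepFun.prodMk_of_sumElim h.measurable_edge_apply h.measurable_noise_apply h.indep).comp
    (fun _ p => (p.1, xor p.1 p.2)) fun _ => measurable_of_countable _

variable [IsProbabilityMeasure P] (h0 : 0 < (γ : ℝ)) (h1 : (γ : ℝ) < 1 / 2)
  (hM : ∀ i j, 0 < (M i j : ℝ) ∧ (M i j : ℝ) < 1)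

include h0 h1 hM

/-- Bayes' rule with the denominator cleared: the train edge is `b` either through an edge with
noise `!b` or through a non-edge with noise `b`. -/
theorem IsFission.train_apply (h : IsFission P M γ A W) (e : Fin n × Fin n) (b : Bool) :
    0 < P.real {ω | train (A ω) (W ω) e.1 e.2 = b} ∧
    P.real ({ω | train (A ω) (W ω) e.1 e.2 = b} ∩ {ω | A ω e.1 e.2 = true})
      = condMean γ (M e.1 e.2) b * P.real {ω | train (A ω) (W ω) e.1 e.2 = b} := by
  obtain ⟨hm0, hm1⟩ := hM e.1 e.2
  have hγ : 0 < 1 - (γ : ℝ) := by linarith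
  have hmeas : ∀ x y, MeasurableSet {ω | A ω e.1 e.2 = x ∧ W ω e.1 e.2 = y} := fun x y =>
    (h.measurable_edge_apply e (measurableSet_singleton x)).inter
      (h.measurable_noise_apply e (measurableSet_singleton y))
  have e1 : {ω | train (A ω) (W ω) e.1 e.2 = b} ∩ {ω | A ω e.1 e.2 = true}
      = {ω | A ω e.1 e.2 = true ∧ W ω e.1 e.2 = !b} := by
    ext ω
    simp only [train, Set.mem_inter_iff, Set.mem_ofPred_eq]
    cases A ω e.1 e.2 <;> cases W ω e.1 e.2 <;> cases b <;> simp
  have e2 : {ω | train (A ω) (W ω) e.1 e.2 = b}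
      = {ω | A ω e.1 e.2 = true ∧ W ω e.1 e.2 = !b} ∪ {ω | A ω e.1 e.2 = false ∧ W ω e.1 e.2 = b} := by
    ext ω
    simp only [train, Set.mem_union, Set.mem_ofPred_eq]
    cases A ω e.1 e.2 <;> cases W ω e.1 e.2 <;> cases b <;> simp
  have hd : Disjoint {ω | A ω e.1 e.2 = true ∧ W ω e.1 e.2 = !b}
      {ω | A ω e.1 e.2 = false ∧ W ω e.1 e.2 = b} := by
    rw [Set.disjoint_left]
    rintro ω ⟨h2, _⟩ ⟨h3, _⟩
    rw [h2] at h3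
    exact absurd h3 (by simp)
  rw [e1, e2, measureReal_union hd (hmeas _ _), h.real_inter, h.real_inter]
  have hm2 : 0 < 1 - (M e.1 e.2 : ℝ) := by linarith
  rw [condMean_eq_tilt h0 h1]
  unfold tilt
  cases b
  · simp only [Bool.not_false, if_true, Bool.false_eq_true, if_false]
    refine ⟨by positivity, ?_⟩
    field_simp
  · simp only [Bool.not_true, if_true, Bool.false_eq_true, if_false]
    refine ⟨by positivity, ?_⟩
    field_simp

theorem IsFission.measure_train_ne_zero (h : IsFission P M γ A W) (a : Network n)
    (e : Fin n × Fin n) :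
    P ((fun ω => train (A ω) (W ω) e.1 e.2) ⁻¹' {a e.1 e.2}) ≠ 0 := by
  intro h'
  have := (h.train_apply h0 h1 hM e (a e.1 e.2)).1
  rw [measureReal_def] at this
  rw [show {ω | train (A ω) (W ω) e.1 e.2 = a e.1 e.2}
    = (fun ω => train (A ω) (W ω) e.1 e.2) ⁻¹' {a e.1 e.2} from rfl, h'] at this
  simp at this

/-- Conditional on the train network, the entries of the test network are independent. -/
theorem IsFission.iIndepFun_cond (h : IsFission P M γ A W) (a : Network n) :
    iIndepFun (fun (e : Fin n × Fin n) ω => A ω e.1 e.2) P[|{ω | train (A ω) (W ω) = a}] := by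
  rw [setOf_train_eq]
  exact iIndepFun.cond (X := fun (e : Fin n × Fin n) ω => A ω e.1 e.2)
    (Y := fun (e : Fin n × Fin n) ω => train (A ω) (W ω) e.1 e.2)
    (t := fun e => {a e.1 e.2}) (measurable_train h) h.iIndepFun_pair
    (h.measure_train_ne_zero h0 h1 hM a) fun e => measurableSet_singleton _

theorem IsFission.measure_cond_ne_zero (h : IsFission P M γ A W) (a : Network n) :
    P {ω | train (A ω) (W ω) = a} ≠ 0 := by
  have hi : iIndepFun (fun (e : Fin n × Fin n) ω => train (A ω) (W ω) e.1 e.2) P :=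
    h.iIndepFun_pair.comp (fun _ p => p.2) fun _ => measurable_snd
  rw [setOf_train_eq, hi.meas_iInter (s := fun e =>
    (fun ω => train (A ω) (W ω) e.1 e.2) ⁻¹' {a e.1 e.2})
    fun e => ⟨{a e.1 e.2}, measurableSet_singleton _, rfl⟩]
  exact Finset.prod_ne_zero_iff.2 fun e _ => h.measure_train_ne_zero h0 h1 hM a e

/-- Conditional on the train network, the entries of the test network have means `condMean`. -/
theorem IsFission.integral_bit_cond (h : IsFission P M γ A W) (a : Network n)
    (e : Fin n × Fin n) :
    ∫ ω, bit (A ω e.1 e.2) ∂P[|{ω | train (A ω) (W ω) = a}]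
      = condMean γ (M e.1 e.2) (a e.1 e.2) := by
  have hmA : MeasurableSet {ω | A ω e.1 e.2 = true} :=
    h.measurable_edge_apply e (measurableSet_singleton true)
  have hbit : (fun ω => bit (A ω e.1 e.2)) = {ω | A ω e.1 e.2 = true}.indicator 1 := by
    ext ω
    simp [bit, Set.indicator_apply]
  -- Applied to the single entry `e`: the train values at other entries carry no information about
  -- it.
  have hprod := cond_iInter (s := {e}) (X := fun (e : Fin n × Fin n) ω => A ω e.1 e.2)
    (Y := fun (e : Fin n × Fin n) ω => train (A ω) (W ω) e.1 e.2) (t := fun e => {a e.1 e.2})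
    (f := fun e => {ω | A ω e.1 e.2 = true}) (measurable_train h) h.iIndepFun_pair
    (fun e _ => ⟨{true}, measurableSet_singleton _, rfl⟩)
    (fun e _ => h.measure_train_ne_zero h0 h1 hM a e) fun e => measurableSet_singleton _
  rw [← setOf_train_eq] at hprod
  simp only [Finset.mem_singleton, Set.iInter_iInter_eq_left, Finset.prod_singleton] at hprod
  obtain ⟨hpos, heq⟩ := h.train_apply h0 h1 hM e (a e.1 e.2)
  rw [hbit, integral_indicator_one hmA, measureReal_def, hprod,
    cond_apply (measurable_train h e (measurableSet_singleton _)), ENNReal.toReal_mul,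
    ENNReal.toReal_inv]
  change (P.real {ω | train (A ω) (W ω) e.1 e.2 = a e.1 e.2})⁻¹
    * P.real ({ω | train (A ω) (W ω) e.1 e.2 = a e.1 e.2} ∩ {ω | A ω e.1 e.2 = true}) = _
  rw [heq]
  field_simp

end Fission

end BernoulliNetwork

/-! ### Target, estimator and standard error as sums over blocks -/

namespace BernoulliNetwork

/-- Both maps multiply the odds by `κ⁻¹`. The endpoints are excluded because `logit` takes the
default value `0` there. -/
theorem shift_eq_tilt {v κ : ℝ} (h0 : 0 < v) (h1 : v < 1) (hκ : 0 < κ) :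
    shift v κ⁻¹ = tilt κ v := by
  have h2 : 0 < 1 - v := by linarith
  have h3 : 0 < v / (1 - v) * κ⁻¹ := by positivity
  have h4 := tiltDen_pos hκ h0.le h1.le
  unfold shift logit tilt
  rw [← Real.log_mul (by positivity) (by positivity), Real.sigmoid_def, Real.exp_neg,
    Real.exp_log h3]
  field_simp

/-- The odds ratio `e^{c^{(s)}}`. -/
theorem exp_c {γ : ℝ} (h0 : 0 < γ) (h1 : γ < 1) (s : Bool) :
    Real.exp (c γ s) = if s then (1 - γ) / γ else γ / (1 - γ) := by
  have : 0 < 1 - γ := by linarith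
  cases s
  · simpa [c] using Real.exp_log (show 0 < γ / (1 - γ) by positivity)
  · simpa [c] using Real.exp_log (show 0 < (1 - γ) / γ by positivity)

section Statistics

variable {n K : ℕ} (γ : ℝ) (M : Fin n → Fin n → unitInterval)
  (u : EuclideanSpace ℝ (Fin K × Fin K)) (A a : Network n) (z : Membership n K)

/-- The coefficient of the block `(s, (l, k))` in the target and in its estimator. -/
def coeff (j : Bool × (Fin K × Fin K)) : ℝ := u.ofLp j.2 * weight a z j.1 j.2.2 j.2.1

/-- The block `(s, (l, k))`, in the order used by `Matrix.vec`. -/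
def vecBlock (j : Bool × (Fin K × Fin K)) : Finset (Fin n × Fin n) :=
  subBlock a z j.1 j.2.2 j.2.1

theorem xiHat_eq : xiHat γ u A a z = ∑ j, coeff u a z j *
    tilt (Real.exp (c γ j.1)) (finsetMean (vecBlock a z j) fun e => bit (A e.1 e.2)) := by
  rw [Fintype.sum_prod_type_right, xiHat, dotProduct]
  refine Finset.sum_congr rfl fun p _ => ?_
  rw [Fintype.sum_bool]
  simp only [Matrix.vec, PhiHat, coeff, vecBlock, Vhat, Bhat, tilt, finsetMean]
  ring

theorem xi_eq {γ : ℝ} (h0 : 0 < γ) (h1 : γ < 1)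
    (hV : ∀ s k l, 0 < V γ M a z s k l ∧ V γ M a z s k l < 1) :
    xi γ M u a z = ∑ j, coeff u a z j * tilt (Real.exp (c γ j.1))
      (finsetMean (vecBlock a z j) fun e => condMean γ (M e.1 e.2) (a e.1 e.2)) := by
  have h2 : 0 < 1 - γ := by linarith
  rw [Fintype.sum_prod_type_right, xi, dotProduct]
  refine Finset.sum_congr rfl fun p _ => ?_
  rw [Fintype.sum_bool]
  simp only [Matrix.vec, Phi, exp_c h0 h1, if_true, Bool.false_eq_true, if_false]
  rw [← inv_div γ, ← inv_div (1 - γ) γ, shift_eq_tilt (hV _ _ _).1 (hV _ _ _).2 (by positivity),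
    shift_eq_tilt (hV _ _ _).1 (hV _ _ _).2 (by positivity)]
  simp only [coeff, vecBlock, V, finsetMean, inv_div]
  ring

theorem sigmaHat_eq : sigmaHat γ u A a z = √(∑ j, coeff u a z j ^ 2 *
    (tiltVar (Real.exp (c γ j.1)) (finsetMean (vecBlock a z j) fun e => bit (A e.1 e.2))
      / ((vecBlock a z j).card : ℝ))) := by
  rw [Fintype.sum_prod_type_right, sigmaHat, dotProduct]
  congr 1
  refine Finset.sum_congr rfl fun p _ => ?_
  rw [Matrix.mulVec_diagonal]
  simp only [Matrix.vec, DeltaHat]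
  rw [Finset.sum_mul, Finset.mul_sum]
  refine Finset.sum_congr rfl fun s _ => ?_
  simp only [coeff, vecBlock, DeltaHatPart, tiltVar, weight, Bhat, finsetMean]
  rw [two_mul, Real.exp_add, div_div, mul_comm (((subBlock a z s p.2 p.1).card : ℝ))]
  ring

variable {z}

/-- A pair of nodes determines its two communities by `hz`, and `s` is read off the train network.
-/
theorem pairwise_disjoint_vecBlock (hz : z.Disjoint) :
    Pairwise fun i j => Disjoint (vecBlock a z i) (vecBlock a z j) := by
  rintro ⟨s, l, k⟩ ⟨s', l', k'⟩ hne
  rw [Finset.disjoint_left]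
  intro e he he'
  simp only [vecBlock, subBlock, block, Finset.mem_filter, Finset.mem_univ, true_and] at he he'
  refine hne ?_
  rw [hz _ _ _ he.1.1 he'.1.1, hz _ _ _ he.1.2 he'.1.2, ← he.2, ← he'.2]

theorem card_subBlock_le (s : Bool) (k l : Fin K) :
    (subBlock a z s k l).card ≤ (block z k l).card :=
  Finset.card_le_card (Finset.filter_subset _ _)

theorem weight_nonneg (s : Bool) (k l : Fin K) : 0 ≤ weight a z s k l := by
  unfold weight; positivity

theorem weight_le_one (s : Bool) (k l : Fin K) : weight a z s k l ≤ 1 :=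
  div_le_one_of_le₀ (by exact_mod_cast card_subBlock_le a s k l) (by positivity)

variable {u}

theorem abs_coeff_le_one (hu : ‖u‖ = 1) (j : Bool × (Fin K × Fin K)) :
    |coeff u a z j| ≤ 1 := by
  have h1 : |u.ofLp j.2| ≤ 1 := by
    have := PiLp.norm_apply_le u j.2
    rwa [hu, Real.norm_eq_abs] at this
  rw [coeff, abs_mul, abs_of_nonneg (weight_nonneg a _ _ _)]
  exact mul_le_one₀ h1 (weight_nonneg a _ _ _) (weight_le_one a _ _ _)

/-- Squared weight over block size is `|I^{(s)}| / |I|²`, at least `C⁻¹ n² / n⁴`; then `‖u‖ = 1` is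
used. Each value of `s` contributes this bound, and one of the two is dropped. -/
theorem le_sum_coeff_sq_div (hu : ‖u‖ = 1) {C : ℝ} (hC : 0 < C) (hn : 0 < n)
    (hs : ∀ j, (vecBlock a z j).Nonempty ∧
      ((vecBlock a z j).card : ℝ)⁻¹ ≤ C * ((n : ℝ) ^ 2)⁻¹) :
    C⁻¹ * ((n : ℝ) ^ 2)⁻¹ ≤ ∑ j, coeff u a z j ^ 2 / ((vecBlock a z j).card : ℝ) := by
  have hn' : (0 : ℝ) < n := by exact_mod_cast hn
  have husum : ∑ p, u.ofLp p ^ 2 = 1 := by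
    have := EuclideanSpace.real_norm_sq_eq u
    rw [hu, one_pow] at this
    exact this.symm
  have hterm : ∀ j, C⁻¹ * ((n : ℝ) ^ 2)⁻¹ * u.ofLp j.2 ^ 2
      ≤ coeff u a z j ^ 2 / ((vecBlock a z j).card : ℝ) := by
    rintro ⟨s, p⟩
    obtain ⟨hne, hle⟩ := hs (s, p)
    have hNpos : (0 : ℝ) < (subBlock a z s p.2 p.1).card := by exact_mod_cast hne.card_pos
    have hBle : ((block z p.2 p.1).card : ℝ) ≤ (n : ℝ) ^ 2 := by
      have := Finset.card_le_univ (block z p.2 p.1)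
      rw [Fintype.card_prod, Fintype.card_fin] at this
      rw [sq]
      exact_mod_cast this
    have hBpos : (0 : ℝ) < (block z p.2 p.1).card :=
      hNpos.trans_le (by exact_mod_cast card_subBlock_le a s p.2 p.1)
    have hN : C⁻¹ * (n : ℝ) ^ 2 ≤ (subBlock a z s p.2 p.1).card := by
      have h2 : C⁻¹ * (n : ℝ) ^ 2 = (C * ((n : ℝ) ^ 2)⁻¹)⁻¹ := by rw [mul_inv, inv_inv]
      rw [h2]
      exact inv_le_of_inv_le₀ hNpos hle
    simp only [coeff, vecBlock, weight]
    calc C⁻¹ * ((n : ℝ) ^ 2)⁻¹ * u.ofLp p ^ 2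
        = u.ofLp p ^ 2 * ((C⁻¹ * (n : ℝ) ^ 2) / ((n : ℝ) ^ 2) ^ 2) := by field_simp
      _ ≤ u.ofLp p ^ 2 * ((subBlock a z s p.2 p.1).card / ((block z p.2 p.1).card : ℝ) ^ 2) := by
          gcongr
      _ = _ := by field_simp
  refine le_trans ?_ (Finset.sum_le_sum fun j _ => hterm j)
  rw [← Finset.mul_sum, Fintype.sum_prod_type, Fintype.sum_bool]
  simp only [husum]
  have : 0 ≤ C⁻¹ * ((n : ℝ) ^ 2)⁻¹ := by positivity
  linarith

end Statistics

theorem InvCardIsBigO.eventually {ι : ℕ → Type*} {I : (n : ℕ) → Finset (ι n)}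
    (h : InvCardIsBigO I) :
    ∀ᶠ C in atTop, ∀ᶠ n : ℕ in atTop,
      (I n).Nonempty ∧ ((I n).card : ℝ)⁻¹ ≤ C * ((n : ℝ) ^ 2)⁻¹ := by
  filter_upwards [Asymptotics.isBigO_iff_eventually.1 h.2] with C hC
  filter_upwards [h.1, hC] with n h1 h2
  refine ⟨h1, ?_⟩
  rwa [Real.norm_of_nonneg (by positivity), Real.norm_of_nonneg (by positivity)] at h2

end BernoulliNetwork

end

/-! ### Coverage conditional on the train network and the detected communities -/

open BernoulliNetwork

/-- `A n` is the network (and the test network), `W n` the fission noise, `train (A n) (W n)` the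
train network.  `detect n a r` is the community membership matrix that the detection algorithm
returns on the train network `a` with auxiliary randomness `r`; `R n` is that randomness.
`a n` and `z n` are the realizations on which one conditions. -/
theorem proposition8
    (K : ℕ) (N₀ N₁ : ℝ) (hN₀ : 0 < N₀) (hN₁ : N₁ < 1)
    (γ : unitInterval) (hγ0 : 0 < (γ : ℝ)) (hγ1 : (γ : ℝ) < 1 / 2)
    (α : ℝ) (hα0 : 0 < α) (hα1 : α < 1)
    (M : (n : ℕ) → Fin n → Fin n → unitInterval)
    (hM : ∀ n i j, N₀ ≤ (M n i j : ℝ) ∧ (M n i j : ℝ) ≤ N₁)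
    {Ω : ℕ → Type*} [∀ n, MeasurableSpace (Ω n)]
    (P : (n : ℕ) → Measure (Ω n)) [∀ n, IsProbabilityMeasure (P n)]
    (A W : (n : ℕ) → Ω n → BernoulliNetwork.Network n)
    (hfission : ∀ n, BernoulliNetwork.IsFission (P n) (M n) γ (A n) (W n))
    {E : ℕ → Type*} [∀ n, MeasurableSpace (E n)]
    (R : (n : ℕ) → Ω n → E n) (hR : ∀ n, Measurable (R n))
    (hRindep : ∀ n, IndepFun (fun ω => (A n ω, W n ω)) (R n) (P n))
    (detect : (n : ℕ) → BernoulliNetwork.Network n → E n → BernoulliNetwork.Membership n K)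
    (hdetect : ∀ n a, Measurable (detect n a))
    (u : (n : ℕ) → BernoulliNetwork.Network n → BernoulliNetwork.Membership n K →
      EuclideanSpace ℝ (Fin K × Fin K))
    (hu : ∀ n a z, ‖u n a z‖ = 1)
    (a : (n : ℕ) → BernoulliNetwork.Network n)
    (z : (n : ℕ) → BernoulliNetwork.Membership n K)
    (hz : ∀ n, (z n).Disjoint)
    (hza : ∀ n, P n {ω | detect n (a n) (R n ω) = z n} ≠ 0)
    (hsize : ∀ (s : Bool) (k l : Fin K),
      BernoulliNetwork.InvCardIsBigO (fun n => BernoulliNetwork.subBlock (a n) (z n) s k l)) :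
    let Atr : (n : ℕ) → Ω n → BernoulliNetwork.Network n :=
      fun n ω => BernoulliNetwork.train (A n ω) (W n ω)
    let Zhat : (n : ℕ) → Ω n → BernoulliNetwork.Membership n K :=
      fun n ω => detect n (Atr n ω) (R n ω)
    let q : ℝ := BernoulliNetwork.normalQuantile (1 - α / 2)
    1 - α ≤ liminf (fun n =>
      ((P n)[|{ω | Atr n ω = a n ∧ Zhat n ω = z n}]).real
        {ω |
          let U := u n (Atr n ω) (Zhat n ω)
          let ξ := BernoulliNetwork.xi γ (M n) U (Atr n ω) (Zhat n ω)
          let ξhat := BernoulliNetwork.xiHat γ U (A n ω) (Atr n ω) (Zhat n ω)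
          let σhat := BernoulliNetwork.sigmaHat γ U (A n ω) (Atr n ω) (Zhat n ω)
          ξ ∈ Set.Icc (ξhat - q * σhat) (ξhat + q * σhat)}) atTop := by
  intro Atr Zhat q
  have hMpos : ∀ n i j, 0 < (M n i j : ℝ) ∧ (M n i j : ℝ) < 1 := fun n i j =>
    ⟨hN₀.trans_le (hM n i j).1, (hM n i j).2.trans_lt hN₁⟩
  have hγ1' : (γ : ℝ) < 1 := by linarith
  have hγ2 : 0 < 1 - (γ : ℝ) := by linarith
  let t₀ := N₀ * ((γ : ℝ) / (1 - γ))
  let t₁ := 1 - (1 - N₁) * ((γ : ℝ) / (1 - γ))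
  have ht₀ : 0 < t₀ := by positivity
  have ht₁ : t₁ < 1 := by
    have : 0 < (1 - N₁) * ((γ : ℝ) / (1 - γ)) := mul_pos (by linarith) (by positivity)
    linarith
  -- Coverage is first proved conditionally on the train network alone; the detected communities
  -- enter at the end.
  let μ : ∀ n, Measure (Ω n) := fun n => (P n)[|{ω | train (A n ω) (W n ω) = a n}]
  have hμ : ∀ n, IsProbabilityMeasure (μ n) := fun n =>
    cond_isProbabilityMeasure ((hfission n).measure_cond_ne_zero hγ0 hγ1 (hMpos n) (a n))
  let X : ∀ n, Fin n × Fin n → Ω n → ℝ := fun n e ω => bit (A n ω e.1 e.2)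
  let T : ∀ n, Fin n × Fin n → ℝ := fun n e => condMean γ (M n e.1 e.2) (a n e.1 e.2)
  have hT : ∀ n e, t₀ ≤ T n e ∧ T n e ≤ t₁ := fun n e =>
    condMean_mem_Icc hγ0 hγ1 hN₀ hN₁ (hM n e.1 e.2) (a n e.1 e.2)
  obtain ⟨C, hC, hC0⟩ := ((eventually_all.2 fun j : Bool × (Fin K × Fin K) =>
    (hsize j.1 j.2.2 j.2.1).eventually).and (eventually_gt_atTop (0 : ℝ))).exists
  have hIC : ∀ᶠ n : ℕ in atTop, ∀ j, (vecBlock (a n) (z n) j).Nonempty ∧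
      ((vecBlock (a n) (z n) j).card : ℝ)⁻¹ ≤ C * ((n : ℝ) ^ 2)⁻¹ := eventually_all.2 hC
  have hcover : ∀ b, 0 ≤ b → b < 1 - α → ∀ᶠ n in atTop, b ≤
      ((P n)[|{ω | Atr n ω = a n ∧ Zhat n ω = z n}]).real
        {ω |
          let U := u n (Atr n ω) (Zhat n ω)
          let ξ := BernoulliNetwork.xi γ (M n) U (Atr n ω) (Zhat n ω)
          let ξhat := BernoulliNetwork.xiHat γ U (A n ω) (Atr n ω) (Zhat n ω)
          let σhat := BernoulliNetwork.sigmaHat γ U (A n ω) (Atr n ω) (Zhat n ω)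
          ξ ∈ Set.Icc (ξhat - q * σhat) (ξhat + q * σhat)} := by
    intro b hb0 hb
    have key := eventually_le_measureReal_abs_sum_tilt_sub_le
      (κ := fun j : Bool × (Fin K × Fin K) => Real.exp (c γ j.1)) (fun j => Real.exp_pos _)
      ht₀ ht₁ μ X
      (fun n e => (measurable_of_countable bit).comp ((hfission n).measurable_edge_apply e))
      (fun n e ω => by simp only [X, bit]; split_ifs <;> simp)
      (fun n => ((hfission n).iIndepFun_cond hγ0 hγ1 (hMpos n) (a n)).comp (fun _ => bit)
        fun _ => measurable_of_countable _)
      T (fun n e => (hfission n).integral_bit_cond hγ0 hγ1 (hMpos n) (a n) e) hT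
      (fun n => vecBlock (a n) (z n)) (fun n => pairwise_disjoint_vecBlock (a n) (hz n))
      (inv_pos.2 hC0) hIC (fun n => coeff (u n (a n) (z n)) (a n) (z n))
      (fun n => abs_coeff_le_one (a n) (hu n _ _))
      (by
        filter_upwards [hIC, eventually_gt_atTop 0] with n h1 h2
        exact le_sum_coeff_sq_div (a n) (hu n _ _) hC0 h2 h1)
      hb0 (hb.trans_le (le_gaussianReal_Icc_normalQuantile hα0 hα1))
    filter_upwards [key, hIC] with n hn hne
    have hV : ∀ s k l, 0 < V γ (M n) (a n) (z n) s k l ∧ V γ (M n) (a n) (z n) s k l < 1 := by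
      intro s k l
      obtain ⟨h1, h2⟩ := finsetMean_mem_Icc (hne (s, (l, k))).1 fun e _ => hT n e
      exact ⟨ht₀.trans_le h1, h2.trans_lt ht₁⟩
    refine hn.trans (le_of_eq ?_)
    have hAW : Measurable fun ω => (A n ω, W n ω) :=
      (hfission n).measurable_edge.prodMk (hfission n).measurable_noise
    have hmeas2 : ∀ S : Set (BernoulliNetwork.Network n × BernoulliNetwork.Network n),
        MeasurableSet S := fun S => S.toFinite.measurableSet
    let S₂ : Set (E n) := detect n (a n) ⁻¹' {z n}
    have hS₂ : MeasurableSet S₂ := hdetect n (a n) (Set.toFinite _).measurableSet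
    -- Once the train network equals `a n`, the detection outcome is an event in `R n` only.
    have hset : {ω | Atr n ω = a n ∧ Zhat n ω = z n}
        = {ω | train (A n ω) (W n ω) = a n} ∩ R n ⁻¹' S₂ := by
      ext ω
      simp only [Atr, Zhat, Set.mem_inter_iff, Set.mem_ofPred_eq, Set.mem_preimage, S₂,
        Set.mem_singleton_iff]
      refine and_congr_right fun h => ?_
      rw [h]
    have hindep : ∀ S : Set (BernoulliNetwork.Network n × BernoulliNetwork.Network n),
        P n ((fun ω => (A n ω, W n ω)) ⁻¹' S ∩ R n ⁻¹' S₂)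
          = P n ((fun ω => (A n ω, W n ω)) ⁻¹' S) * P n (R n ⁻¹' S₂) := fun S =>
      (hRindep n).measure_inter_preimage_eq_mul _ _ (hmeas2 S) hS₂
    rw [hset]
    symm
    -- The coverage event with train network and communities frozen at `a n` and `z n`. It is
    -- determined by the test network, hence independent of `R n`, and agrees with the original
    -- event on the conditioning event.
    let G : Set (BernoulliNetwork.Network n) := {A' | |∑ j, coeff (u n (a n) (z n)) (a n) (z n) j
        * (tilt (Real.exp (c γ j.1)) (finsetMean (vecBlock (a n) (z n) j) fun e => bit (A' e.1 e.2))
          - tilt (Real.exp (c γ j.1)) (finsetMean (vecBlock (a n) (z n) j) (T n)))|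
      ≤ q * sigmaHat γ (u n (a n) (z n)) A' (a n) (z n)}
    have hG : {ω | |∑ j, coeff (u n (a n) (z n)) (a n) (z n) j
        * (tilt (Real.exp (c γ j.1)) (finsetMean (vecBlock (a n) (z n) j) fun e => X n e ω)
          - tilt (Real.exp (c γ j.1)) (finsetMean (vecBlock (a n) (z n) j) (T n)))|
      ≤ q * √(∑ j, coeff (u n (a n) (z n)) (a n) (z n) j ^ 2 * (tiltVar (Real.exp (c γ j.1))
        (finsetMean (vecBlock (a n) (z n) j) fun e => X n e ω)
        / ((vecBlock (a n) (z n) j).card : ℝ)))} = A n ⁻¹' G := by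
      ext ω
      simp only [G, Set.mem_ofPred_eq, Set.mem_preimage, sigmaHat_eq, X]
    rw [hG]
    refine cond_inter_real_eq (P := P n) (hAW (hmeas2 {p | train p.1 p.2 = a n}))
      (hR n hS₂) ?_ (hindep {p | train p.1 p.2 = a n})
      (hindep {p | train p.1 p.2 = a n ∧ p.1 ∈ G}) (hza n)
    intro ω hω
    rw [← hset] at hω
    obtain ⟨h1, h2⟩ := hω
    simp only [Set.mem_ofPred_eq, h1, h2, Set.mem_preimage, G]
    simp only [mul_sub, Finset.sum_sub_distrib]
    rw [← xiHat_eq, ← xi_eq (M n) (u n (a n) (z n)) (a n) (z n) hγ0 hγ1' hV, Set.mem_Icc, abs_le]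
    constructor <;> rintro ⟨h3, h4⟩ <;> constructor <;> linarith
  -- Every level strictly below `1 - α` is eventually reached. The maximum with `0` meets the
  -- nonnegativity required by `hcover`.
  refine le_of_forall_lt fun b hb => ?_
  obtain ⟨b', hb1, hb2⟩ := exists_between (max_lt hb (show (0 : ℝ) < 1 - α by linarith))
  refine lt_of_lt_of_le ((le_max_left _ _).trans_lt hb1) (le_liminf_of_le ?_
    (hcover b' ((le_max_right _ _).trans hb1.le) hb2))
  exact IsBoundedUnder.isCoboundedUnder_ge
    (isBoundedUnder_of ⟨1, fun n => measureReal_le_one⟩)
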